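/- **Setting.** Let $\rho>0$ be a density. A *Medium III* tensor with moduli $(\mu_{11},\mu_{44},\mu_{66})$ is the fourth-order tensor on $\mathbb R^3$ whose Voigt matrix has diagonal $(\mu_{11},\mu_{11},\mu_{11},\mu_{44},\mu_{44},\mu_{66})$, entry $\mu_{11}-2\mu_{66}$ at $(1,2)$, entries $\mu_{11}-2\mu_{44}$ at $(1,3)$ and $(2,3)$ (symmetric), and zeros elsewhere. Let the stiffness tensor $C$ (moduli $c_{pq}$, $c_{11},c_{44}>0$) and the viscosity tensor $V$ (moduli $v_{pq}$) be of this type. The eigenvalues of the Christoffel tensor $\Gamma_{ij}(\nabla)=\sum_{k,l}C_{kilj}\partial_k\partial_l$ are $L_1^c=c_{11}\Delta$, $L_2^c=c_{66}(\partial_1^2+\partial_2^2)+c_{44}\partial_3^2$, $L_3^c=c_{44}\Delta$ (likewise $L_i^v$ for $V$), and we assume $L^v_i=\beta_iL^c_i$ with real $\beta_i$. Put $D_1=(\partial_1,\partial_2,\partial_3)$, $D_2=(\partial_2,-\partial_1,0)$, $M_1=\Delta$, $M_2=\partial_1^2+\partial_2^2$ and $c_p=\sqrt{c_{pp}/\rho}$.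 Fix a frequency $\omega\in\mathbb R$, the value $\widehat{\mathcal A}=\widehat{\mathcal A}(\omega)\in\mathbb C$ of the Fourier transform of the loss operator, and a branch of the complex square root. Put $K_i=\sqrt{\omega^2(1-\beta_i\widehat{\mathcal A})}$ and $$\Phi_i(h)=(1-\beta_i\widehat{\mathcal A})\frac{e^{\sqrt{-1}K_ih}}{4\pi\rho\, b_{i1}b_{i2}b_{i3}\,h},\qquad \Phi_i(x)=\Phi_i(\tau_i(x)),\qquad \tau_i(x)=\Big(\sum_{j=1}^3 x_j^2/b_{ij}^2\Big)^{1/2},$$ where $b_1=(c_1,c_1,c_1)$, $b_2=(c_6,c_6,c_4)$, $b_3=(c_4,c_4,c_4)$. The Green function of Medium III is $$\widehat G=\Phi_3I+D_1\otimes D_1\,M_1^{-1}(\Phi_1-\Phi_3)+D_2\otimes D_2\,M_2^{-1}(\Phi_2-\Phi_3)\qquad(x\neq0).$$ Here $\Psi=M^{-1}f$ denotes a solution of $M\Psi=f$ on $\mathbb R^3\setminus\{0\}$ that is smooth there, has bounded gradient near $0$, and is invariant under every linear isometry of $\mathbb R^3$ that leaves both $M$ and $f$ invariant. **Theorem.**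 Suppose $c_{66}=c_{44}$. Then $C$ and $V$ are isotropic, $\beta_2=\beta_3$, $\tau_1=r/c_1$, $\tau_2=\tau_3=r/c_4$ and $\Phi_2=\Phi_3$, where $r=|x|$. Each $\Phi_i$ is locally integrable and satisfies $L_i^c\Phi_i+\rho\omega^2(1-\beta_i\widehat{\mathcal A})\Phi_i=-(1-\beta_i\widehat{\mathcal A})\delta$ in the sense of distributions on $\mathbb R^3$. The Green function $\widehat G$ exists, is uniquely determined at every $x\ne0$, and with $\hat r=x/r$ equals $$\widehat G=\Phi_2I+D_1\otimes D_1M_1^{-1}(\Phi_1-\Phi_2)=\Phi_1\,\hat r\otimes\hat r+\Phi_2\,(I-\hat r\otimes\hat r)+\frac1{r^3}\Big[c_1^3\int_0^{r/c_1}h^2\Phi_1(h)\,dh-c_4^3\int_0^{r/c_4}h^2\Phi_2(h)\,dh\Big](I-3\hat r\otimes\hat r),$$ for any choice of the potential $M_1^{-1}(\Phi_1-\Phi_2)$ in the above sense. Moreover, if $1-\beta_i\widehat{\mathcal A}\neq0$ for $i=1,2,3$, then $\widehat G$ is locally integrable and is a Green function of the isotropic viscoelastic medium in the frequency domain: $$\widetilde\Gamma(\nabla)\widehat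 G+\rho\omega^2\widehat G=-\delta I$$ in the sense of distributions on $\mathbb R^3$, where $\widetilde\Gamma$ is the Christoffel tensor with the complex moduli $c_{11}/(1-\beta_1\widehat{\mathcal A})$, $c_{44}/(1-\beta_3\widehat{\mathcal A})$ and $c_{66}/(1-\beta_2\widehat{\mathcal A})$. These agree with the moduli of $C+\widehat{\mathcal A}V$ up to terms of second order in $\beta_i$. -/

import Mathlib

open MeasureTheory Filter Topology
open scoped ContDiff

/-- Physical space. -/
abbrev E3 : Type := EuclideanSpace ℝ (Fin 3)

/-! ### Constant-coefficient second order operators -/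

/-- The partial derivative `∂ᵢ f`. -/
noncomputable def pderiv3 (i : Fin 3) (f : E3 → ℂ) : E3 → ℂ :=
  fun x => fderiv ℝ f x (EuclideanSpace.single i 1)

/-- The quadratic form `q(n) = ∑ⱼₖ qⱼₖ nⱼ nₖ`. -/
def quadSymbol (q : Matrix (Fin 3) (Fin 3) ℝ) (n : E3) : ℝ :=
  ∑ j, ∑ k, q j k * n j * n k

/-- The differential operator `q(∇) = ∑ⱼₖ qⱼₖ ∂ⱼ ∂ₖ`. -/
noncomputable def quadOp (q : Matrix (Fin 3) (Fin 3) ℂ) (f : E3 → ℂ) : E3 → ℂ :=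
  fun x => ∑ j, ∑ k, q j k * pderiv3 j (pderiv3 k f) x

/-- A real matrix of coefficients seen as a complex one. -/
noncomputable def toC (q : Matrix (Fin 3) (Fin 3) ℝ) : Matrix (Fin 3) (Fin 3) ℂ :=
  q.map (fun a => (a : ℂ))

/-! ### Medium III: stiffness tensor, Christoffel tensor and its spectral data -/

/-- The three independent moduli `μ₁₁, μ₄₄, μ₆₆` of a Medium III tensor. -/
structure Moduli (R : Type) where
  m11 : R
  m44 : R
  m66 : R

/-- The Voigt index `p(i,j)` (with indices starting from `0`). -/
def voigtIndex : Fin 3 → Fin 3 → Fin 6 :=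
  ![![0, 5, 4], ![5, 1, 3], ![4, 3, 2]]

/-- The Voigt matrix of Medium III. -/
def mediumIIIVoigt {R : Type} [CommRing R] (μ : Moduli R) : Matrix (Fin 6) (Fin 6) R :=
  !![μ.m11, μ.m11 - 2 * μ.m66, μ.m11 - 2 * μ.m44, 0, 0, 0;
     μ.m11 - 2 * μ.m66, μ.m11, μ.m11 - 2 * μ.m44, 0, 0, 0;
     μ.m11 - 2 * μ.m44, μ.m11 - 2 * μ.m44, μ.m11, 0, 0, 0;
     0, 0, 0, μ.m44, 0, 0;
     0, 0, 0, 0, μ.m44, 0;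
     0, 0, 0, 0, 0, μ.m66]

/-- The fourth order tensor `C_{ijkl} = c_{p(i,j) p(k,l)}` of Medium III. -/
def mediumIIITensor {R : Type} [CommRing R] (μ : Moduli R) (i j k l : Fin 3) : R :=
  mediumIIIVoigt μ (voigtIndex i j) (voigtIndex k l)

/-- A fourth order tensor is isotropic if it is invariant under every orthogonal change of
axes. -/
def IsIsotropicTensor (C : Fin 3 → Fin 3 → Fin 3 → Fin 3 → ℝ) : Prop :=
  ∀ Q ∈ Matrix.orthogonalGroup (Fin 3) ℝ, ∀ i j k l : Fin 3,
    ∑ a, ∑ b, ∑ c, ∑ d, Q i a * Q j b * Q k c * Q l d * C a b c d = C i j k l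

/-- The `(i,j)` entry of the Christoffel tensor, `Γᵢⱼ(n) = ∑ₖₗ C_{kilj} nₖ nₗ`, given by its
matrix of coefficients in `(k,l)`. -/
def christoffel {R : Type} [CommRing R] (μ : Moduli R) (i j : Fin 3) :
    Matrix (Fin 3) (Fin 3) R :=
  Matrix.of fun k l => mediumIIITensor μ k i l j

/-- The eigenvalues `L₁, L₂, L₃` of the Christoffel tensor of Medium III:
`μ₁₁ Δ`, `μ₆₆ (∂₁² + ∂₂²) + μ₄₄ ∂₃²` and `μ₄₄ Δ`. -/
def eigL (μ : Moduli ℝ) : Fin 3 → Matrix (Fin 3) (Fin 3) ℝ :=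
  ![Matrix.diagonal ![μ.m11, μ.m11, μ.m11],
    Matrix.diagonal ![μ.m66, μ.m66, μ.m44],
    Matrix.diagonal ![μ.m44, μ.m44, μ.m44]]

/-- The eigenvector `D₁ = (∂₁, ∂₂, ∂₃)`: row `a` holds the coefficients of its component `a`. -/
def vecD1 : Matrix (Fin 3) (Fin 3) ℝ := !![1, 0, 0; 0, 1, 0; 0, 0, 1]

/-- The eigenvector `D₂ = (∂₂, -∂₁, 0)`. -/
def vecD2 : Matrix (Fin 3) (Fin 3) ℝ := !![0, 1, 0; -1, 0, 0; 0, 0, 0]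

/-- The entry `(a,b)` of `D ⊗ D`, a quadratic form in `∇`. -/
def tensorSq (D : Matrix (Fin 3) (Fin 3) ℝ) (a b : Fin 3) : Matrix (Fin 3) (Fin 3) ℝ :=
  Matrix.of fun j k => D a j * D b k

/-- `M = D · D`, a quadratic form in `∇`: `Δ` for `D₁` and `∂₁² + ∂₂²` for `D₂`. -/
def normSqM (D : Matrix (Fin 3) (Fin 3) ℝ) : Matrix (Fin 3) (Fin 3) ℝ :=
  ∑ a, tensorSq D a a

/-- `Ψ = M⁻¹ f`: the solution of `M(∇) Ψ = f` that is smooth away from the origin, has bounded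
gradient at the origin (so that no point source sits there) and is symmetric in the sense that
it inherits every symmetry that is shared by `M` and the source `f`. -/
def IsPotential (M : Matrix (Fin 3) (Fin 3) ℝ) (f Ψ : E3 → ℂ) : Prop :=
  ContDiffOn ℝ ∞ Ψ {0}ᶜ ∧
  (∀ x, x ≠ 0 → quadOp (toC M) Ψ x = f x) ∧
  (∃ B : ℝ, ∀ᶠ x in 𝓝[≠] (0 : E3), ‖fderiv ℝ Ψ x‖ ≤ B) ∧
  (∀ U : E3 ≃ₗᵢ[ℝ] E3, (∀ n, quadSymbol M (U n) = quadSymbol M n) →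
    (∀ x, f (U x) = f x) → ∀ x, Ψ (U x) = Ψ x)

/-! ### The scalar wave functions -/

/-- The data of the problem at a fixed frequency: the density `ρ`, the stiffness moduli `c`, the
ratios `β₁, β₂, β₃` of viscosity to stiffness, the frequency `freq = ω`, the value `A = Â(ω)` of the
Fourier transform of the loss operator, and a branch `sq` of the complex square root. -/
structure WaveData where
  ρ : ℝ
  c : Moduli ℝ
  β : Fin 3 → ℝ
  freq : ℝ
  A : ℂ
  sq : ℂ → ℂ

namespace WaveData

variable (P : WaveData)

/-- `c₁ = √(c₁₁/ρ)`. -/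
noncomputable def c1 : ℝ := √(P.c.m11 / P.ρ)

/-- `c₄ = √(c₄₄/ρ)`. -/
noncomputable def c4 : ℝ := √(P.c.m44 / P.ρ)

/-- `c₆ = √(c₆₆/ρ)`. -/
noncomputable def c6 : ℝ := √(P.c.m66 / P.ρ)

/-- The constants `(b₁, b₂, b₃)` of the three wave modes of Medium III. -/
noncomputable def b : Fin 3 → Fin 3 → ℝ :=
  ![![P.c1, P.c1, P.c1], ![P.c6, P.c6, P.c4], ![P.c4, P.c4, P.c4]]

/-- The factor `1 - βᵢ Â(ω)`. -/
noncomputable def loss (i : Fin 3) : ℂ := 1 - P.β i * P.A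

/-- `Kᵢ(ω) = √(ω² (1 - βᵢ Â(ω)))`. -/
noncomputable def K (i : Fin 3) : ℂ := P.sq ((P.freq : ℂ) ^ 2 * P.loss i)

/-- The travel time `τᵢ(x) = √(x₁²/b₁² + x₂²/b₂² + x₃²/b₃²)`. -/
noncomputable def τ (i : Fin 3) (x : E3) : ℝ := √(∑ j, x j ^ 2 / P.b i j ^ 2)

/-- `Φᵢ` as a function `Φᵢ(h, ω)` of the travel time `h`. -/
noncomputable def profile (i : Fin 3) (h : ℝ) : ℂ :=
  P.loss i * Complex.exp (Complex.I * P.K i * h) /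
    (4 * (∏ j, P.b i j : ℝ) * P.ρ * Real.pi * h)

/-- `Φᵢ(x, ω)`. -/
noncomputable def Φ (i : Fin 3) (x : E3) : ℂ := P.profile i (P.τ i x)

/-- `G` is the spectral Green function of Medium III,
`G = Φ₃ I + D₁⊗D₁ M₁⁻¹ (Φ₁ - Φ₃) + D₂⊗D₂ M₂⁻¹ (Φ₂ - Φ₃)` away from the source. -/
def IsMediumIIIGreen (G : E3 → Matrix (Fin 3) (Fin 3) ℂ) : Prop :=
  ∃ Ψ₁ Ψ₂ : E3 → ℂ,
    IsPotential (normSqM vecD1) (fun x => P.Φ 0 x - P.Φ 2 x) Ψ₁ ∧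
    IsPotential (normSqM vecD2) (fun x => P.Φ 1 x - P.Φ 2 x) Ψ₂ ∧
    ∀ x, x ≠ 0 → G x = P.Φ 2 x • (1 : Matrix (Fin 3) (Fin 3) ℂ) +
      (Matrix.of fun a b => quadOp (toC (tensorSq vecD1 a b)) Ψ₁ x) +
      (Matrix.of fun a b => quadOp (toC (tensorSq vecD2 a b)) Ψ₂ x)

/-- The closed form of the isotropic Green function,
`Φ₁ r̂⊗r̂ + Φ₂ (I - r̂⊗r̂)
  + r⁻³ [c₁³ ∫₀^{r/c₁} h² Φ₁(h) dh - c₄³ ∫₀^{r/c₄} h² Φ₂(h) dh] (I - 3 r̂⊗r̂)`. -/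
noncomputable def isotropicGreen (x : E3) : Matrix (Fin 3) (Fin 3) ℂ :=
  let r : ℝ := ‖x‖
  let rr : Matrix (Fin 3) (Fin 3) ℂ := Matrix.of fun i j => ((x i / r * (x j / r) : ℝ) : ℂ)
  P.Φ 0 x • rr + P.Φ 1 x • (1 - rr) +
    ((r : ℂ) ^ 3)⁻¹ •
      (((P.c1 : ℂ) ^ 3 * ∫ h in (0 : ℝ)..(r / P.c1), (h : ℂ) ^ 2 * P.profile 0 h) -
        ((P.c4 : ℂ) ^ 3 * ∫ h in (0 : ℝ)..(r / P.c4), (h : ℂ) ^ 2 * P.profile 1 h)) •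
      (1 - (3 : ℂ) • rr)

/-- The frequency domain moduli: `c₁₁/(1 - β₁Â)`, `c₄₄/(1 - β₃Â)` and `c₆₆/(1 - β₂Â)`. Up to
terms of second order in `βᵢ` these are the moduli `c + Â v` of the viscoelastic law. -/
noncomputable def viscoModuli : Moduli ℂ where
  m11 := P.c.m11 / P.loss 0
  m44 := P.c.m44 / P.loss 2
  m66 := P.c.m66 / P.loss 1

end WaveData

/-- `q(∇) f + κ f = s δ` on `ℝ³`, in the sense of distributions. -/
def IsScalarFundamental (q : Matrix (Fin 3) (Fin 3) ℂ) (κ s : ℂ) (f : E3 → ℂ) : Prop :=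
  LocallyIntegrable f volume ∧
  ∀ φ : E3 → ℂ, ContDiff ℝ ∞ φ → HasCompactSupport φ →
    ∫ x, f x * (quadOp q φ x + κ * φ x) = s * φ 0

/-- `Γ(∇) G + κ G = s δ I` on `ℝ³` for a Christoffel tensor `Γ`, in the sense of
distributions. -/
def IsElasticFundamental (μ : Moduli ℂ) (κ s : ℂ) (G : E3 → Matrix (Fin 3) (Fin 3) ℂ) : Prop :=
  (∀ i j, LocallyIntegrable (fun x => G x i j) volume) ∧
  ∀ φ : E3 → ℂ, ContDiff ℝ ∞ φ → HasCompactSupport φ → ∀ i j : Fin 3,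
    ∫ x, ∑ k, G x k j *
        (quadOp (christoffel μ i k) φ x + κ * (1 : Matrix (Fin 3) (Fin 3) ℂ) i k * φ x) =
      s * (1 : Matrix (Fin 3) (Fin 3) ℂ) i j * φ 0

/-
Away from the origin a function with gradient `(F(r) / r³) x` has Laplacian `F'(r) / r²`. A
rotation-invariant potential of a radial source is of this form, and Gauss' law determines its flux
up to the constant `F(0)`, which vanishes when the gradient is bounded. So every potential of
`Φ₁ - Φ₂` has the Hessian of the closed form. For the horizontal potential the source
`Φ₂ - Φ₃` is zero: on each horizontal plane it is a rotation-invariant harmonic function, constant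
by the mean value property, so the `D₂ ⊗ D₂` term vanishes.

In the elastic equation the shear modulus acts only on the scalar part `Φ₂ I`, because the
operator `Γ̃` transfers `∂ᵢ∂ⱼΨ` to the divergence of the test field, where only the longitudinal
modulus remains. The gradient parts then cancel because `ρω²∇Ψ` is the difference of the gradients
of two spherical waves.
-/

theorem integral_eq_zero_of_hasLineDerivAt_prod {E F : Type*} [NormedAddCommGroup E]
    [NormedSpace ℝ E] [MeasurableSpace E] {μ : Measure E} [SFinite μ] [NullSingletonClass μ]
    [NormedAddCommGroup F] [NormedSpace ℝ F] {g g' : E × ℝ → F}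
    (hg : Integrable g (μ.prod volume)) (hg' : Integrable g' (μ.prod volume))
    (hderiv : ∀ x ≠ 0, HasLineDerivAt ℝ g (g' x) x (0, 1)) : ∫ x, g' x ∂μ.prod volume = 0 := by
  rw [integral_prod _ hg']
  have hne : ∀ᵐ y ∂μ, y ≠ 0 := by simp [ae_iff]
  refine integral_eq_zero_of_ae ?_
  filter_upwards [hg.prod_right_ae, hg'.prod_right_ae, hne] with y hy hy' hy0
  refine integral_eq_zero_of_hasDerivAt_of_integrable (fun t => ?_) hy' hy
  have hline := (hderiv (y, t) fun h => hy0 (congrArg Prod.fst h)).scomp_of_eq t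
    ((hasDerivAt_id t).sub_const t) (by simp)
  simpa [Function.comp_def] using hline

section GeneralAnalysis

open Module

variable {E F : Type*} [NormedAddCommGroup E] [NormedSpace ℝ E] [FiniteDimensional ℝ E]
  [MeasurableSpace E] [BorelSpace E] {μ : Measure E} [μ.IsAddHaarMeasure]
  [NormedAddCommGroup F]

theorem locallyIntegrable_of_norm_pow_mul_norm_le {n : ℕ} (hn : n < finrank ℝ E) {g : E → F}
    (hg : ContinuousOn g {0}ᶜ)
    {C : ℝ → ℝ} (hC : Continuous C) (hbound : ∀ x ≠ 0, ‖x‖ ^ n * ‖g x‖ ≤ C ‖x‖) :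
    LocallyIntegrable g μ := by
  have : Nontrivial E := nontrivial_of_finrank_pos (R := ℝ) (by lia)
  have hmeas : AEStronglyMeasurable g μ := by
    rw [← restrict_compl_singleton (μ := μ) (0 : E)]
    exact hg.aestronglyMeasurable (measurableSet_singleton 0).compl
  rw [locallyIntegrable_iff]
  intro k hk
  obtain ⟨R, hR⟩ := hk.isBounded.subset_ball (0 : E)
  have hpow : IntegrableOn (fun x : E => C ‖x‖ * (‖x‖ ^ n)⁻¹) (Metric.ball 0 R) μ := by
    refine (integrableOn_fun_norm_addHaar μ (f := fun r : ℝ => C r * (r ^ n)⁻¹)).2 ?_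
    have hcont : IntegrableOn (fun r : ℝ => C r * r ^ (finrank ℝ E - 1 - n)) (Set.Ioo 0 R) :=
      (Continuous.integrableOn_Icc (by fun_prop)).mono_set Set.Ioo_subset_Icc_self
    refine hcont.congr_fun (fun r hr => ?_) measurableSet_Ioo
    have hsplit : r ^ (finrank ℝ E - 1) = r ^ (finrank ℝ E - 1 - n) * r ^ n := by
      rw [← pow_add]
      congr 1
      lia
    have : r ^ n ≠ 0 := pow_ne_zero n hr.1.ne'
    simp only [smul_eq_mul, hsplit]
    field_simp
  refine IntegrableOn.mono_set ?_ hR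
  refine Integrable.mono' hpow hmeas.restrict ?_
  have hne : ∀ᵐ x ∂μ, x ≠ 0 := by simp [ae_iff]
  filter_upwards [ae_restrict_of_ae hne] with x hx
  have hpos : 0 < ‖x‖ ^ n := pow_pos (norm_pos_iff.2 hx) n
  rw [← div_eq_mul_inv, le_div_iff₀' hpos]
  exact hbound x hx

variable [NormedSpace ℝ F]

-- In dimension at least two almost every line misses the origin, so a singularity of `g` there
-- does not matter.
theorem integral_eq_zero_of_hasLineDerivAt_compl_zero (hdim : 2 ≤ finrank ℝ E) {g g' : E → F}
    {v : E} (hg : Integrable g μ) (hg' : Integrable g' μ)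
    (hderiv : ∀ x ≠ 0, HasLineDerivAt ℝ g (g' x) x v) : ∫ x, g' x ∂μ = 0 := by
  have : Nontrivial E := nontrivial_of_finrank_pos (R := ℝ) (by lia)
  rcases eq_or_ne v 0 with rfl | hv
  · have hne : ∀ᵐ x ∂μ, x ≠ 0 := by simp [ae_iff]
    refine integral_eq_zero_of_ae ?_
    filter_upwards [hne] with x hx
    exact (hderiv x hx).unique hasLineDerivAt_zero
  obtain ⟨n, hn⟩ := Nat.exists_eq_add_of_le hdim
  obtain ⟨L, hL⟩ : ∃ L : E ≃L[ℝ] (Fin (n + 1) → ℝ) × ℝ, L v = (0, 1) := by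
    let L₀ : E ≃L[ℝ] (Fin (n + 1) → ℝ) × ℝ :=
      ContinuousLinearEquiv.ofFinrankEq (by simp [hn]; ring)
    obtain ⟨T, hT⟩ := SeparatingDual.exists_continuousLinearEquiv_apply_eq (R := ℝ)
      (x := L₀ v) (y := ((0 : Fin (n + 1) → ℝ), (1 : ℝ))) (by simpa using hv) (by simp)
    exact ⟨L₀.trans T, hT⟩
  have hemb : MeasurableEmbedding L := L.toHomeomorph.measurableEmbedding
  let ν : Measure ((Fin (n + 1) → ℝ) × ℝ) := volume.prod volume
  have hmap : ∀ {h : E → F}, Integrable h μ → Integrable (h ∘ L.symm) ν := fun hh => by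
    rw [Measure.isAddLeftInvariant_eq_smul ν (μ.map L)]
    refine Integrable.smul_measure_nnreal ?_
    simpa [hemb.integrable_map_iff, Function.comp_def] using hh
  calc ∫ x, g' x ∂μ = ∫ y, (g' ∘ L.symm) y ∂μ.map L := by
        rw [hemb.integral_map]
        simp
    _ = Measure.addHaarScalarFactor (μ.map L) ν • ∫ y, (g' ∘ L.symm) y ∂ν := by
        rw [← integral_smul_nnreal_measure, ← Measure.isAddLeftInvariant_eq_smul]
    _ = 0 := by
        rw [integral_eq_zero_of_hasLineDerivAt_prod (hmap hg) (hmap hg') fun y hy => ?_, smul_zero]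
        have hy' : L.symm y ≠ 0 := by simpa using hy
        have hcomp : g = (g ∘ L.symm) ∘ (L : E →ₗ[ℝ] (Fin (n + 1) → ℝ) × ℝ) := by
          ext x
          simp
        have hd := hderiv (L.symm y) hy'
        rw [hcomp] at hd
        simpa [hL] using hd.of_comp

end GeneralAnalysis

section PolarCoordinates

open Module

theorem apply_eq_comp_homeomorphUnitSphereProd {E α : Type*} [NormedAddCommGroup E]
    [NormedSpace ℝ E] (g : E → α) (x : ({0}ᶜ : Set E)) :
    g x = (fun p : Metric.sphere (0 : E) 1 × Set.Ioi (0 : ℝ) => g ((p.2 : ℝ) • (p.1 : E)))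
      (homeomorphUnitSphereProd E x) := by
  have h := homeomorphUnitSphereProd_symm_apply_coe E (homeomorphUnitSphereProd E x)
  rw [Homeomorph.symm_apply_apply] at h
  simp only [← h]

theorem integrable_volumeIoiPow_iff {F : Type*} [NormedAddCommGroup F] [NormedSpace ℝ F]
    {n : ℕ} {h : ℝ → F} :
    Integrable (fun r : Set.Ioi (0 : ℝ) => h r) (Measure.volumeIoiPow n) ↔
      IntegrableOn (fun r => r ^ n • h r) (Set.Ioi 0) := by
  rw [Measure.volumeIoiPow, integrable_withDensity_iff_integrable_smul' (by fun_prop) (by simp),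
    integrableOn_iff_comap_subtypeVal measurableSet_Ioi]
  refine integrable_congr (ae_of_all _ fun r => ?_)
  have hr : (0 : ℝ) ≤ (r : ℝ) ^ n := pow_nonneg (le_of_lt r.2) n
  simp [ENNReal.toReal_ofReal hr]

theorem integral_volumeIoiPow {F : Type*} [NormedAddCommGroup F] [NormedSpace ℝ F] (n : ℕ)
    (h : ℝ → F) :
    ∫ r : Set.Ioi (0 : ℝ), h r ∂Measure.volumeIoiPow n = ∫ r in Set.Ioi 0, r ^ n • h r := by
  rw [Measure.volumeIoiPow, integral_withDensity_eq_integral_toReal_smul (by fun_prop) (by simp),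
    ← integral_subtype_comap measurableSet_Ioi fun r : ℝ => r ^ n • h r]
  refine integral_congr_ae (ae_of_all _ fun r => ?_)
  have hr : (0 : ℝ) ≤ (r : ℝ) ^ n := pow_nonneg (le_of_lt r.2) n
  simp only [ENNReal.toReal_ofReal hr]

variable {E F : Type*} [NormedAddCommGroup E] [NormedSpace ℝ E] [FiniteDimensional ℝ E]
  [MeasurableSpace E] [BorelSpace E] {μ : Measure E} [μ.IsAddHaarMeasure]
  [NormedAddCommGroup F]

theorem integrable_smul_unitSphere {g : E → F} (hg : Integrable g μ) :
    Integrable (fun p : Metric.sphere (0 : E) 1 × Set.Ioi (0 : ℝ) => g ((p.2 : ℝ) • (p.1 : E)))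
      (μ.toSphere.prod (Measure.volumeIoiPow (finrank ℝ E - 1))) := by
  rw [← μ.measurePreserving_homeomorphUnitSphereProd.integrable_comp_emb
    (homeomorphUnitSphereProd E).measurableEmbedding]
  have h : IntegrableOn g ({0}ᶜ : Set E) μ := hg.integrableOn
  rw [integrableOn_iff_comap_subtypeVal (measurableSet_singleton _).compl] at h
  exact h.congr (ae_of_all _ (apply_eq_comp_homeomorphUnitSphereProd g))

variable [NormedSpace ℝ F]

theorem ae_toSphere_integrableOn_Ioi {g : E → F} (hg : Integrable g μ) :
    ∀ᵐ σ : Metric.sphere (0 : E) 1 ∂μ.toSphere,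
      IntegrableOn (fun r : ℝ => r ^ (finrank ℝ E - 1) • g (r • (σ : E))) (Set.Ioi 0) := by
  filter_upwards [(integrable_smul_unitSphere hg).prod_right_ae] with σ hσ
  exact integrable_volumeIoiPow_iff.1 hσ

variable [Nontrivial E]

theorem integral_eq_integral_toSphere {g : E → F} (hg : Integrable g μ) :
    ∫ x, g x ∂μ = ∫ σ : Metric.sphere (0 : E) 1,
      (∫ r in Set.Ioi (0 : ℝ), r ^ (finrank ℝ E - 1) • g (r • (σ : E))) ∂μ.toSphere := by
  calc ∫ x, g x ∂μ = ∫ x : ({0}ᶜ : Set E), g x ∂(μ.comap (↑)) := by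
        rw [integral_subtype_comap (measurableSet_singleton _).compl g,
          restrict_compl_singleton]
    _ = ∫ p : Metric.sphere (0 : E) 1 × Set.Ioi (0 : ℝ), g ((p.2 : ℝ) • (p.1 : E))
          ∂(μ.toSphere.prod (Measure.volumeIoiPow (finrank ℝ E - 1))) := by
        rw [← μ.measurePreserving_homeomorphUnitSphereProd.integral_comp
          (homeomorphUnitSphereProd E).measurableEmbedding]
        exact integral_congr_ae (ae_of_all _ (apply_eq_comp_homeomorphUnitSphereProd g))
    _ = _ := by
        rw [integral_prod _ (integrable_smul_unitSphere hg)]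
        exact integral_congr_ae (ae_of_all _ fun σ =>
          integral_volumeIoiPow _ fun r => g (r • (σ : E)))

theorem integral_inv_norm_pow_smul_radial_deriv [CompleteSpace F] {h h' : E → F}
    (hcont : ContinuousAt h 0) (hsupp : HasCompactSupport h)
    (hderiv : ∀ x ≠ 0, HasLineDerivAt ℝ h (h' x) x (‖x‖⁻¹ • x))
    (hint : Integrable (fun x => (‖x‖ ^ (finrank ℝ E - 1))⁻¹ • h' x) μ) :
    ∫ x, (‖x‖ ^ (finrank ℝ E - 1))⁻¹ • h' x ∂μ = -(μ.toSphere.real Set.univ • h 0) := by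
  have hray : ∀ (σ : Metric.sphere (0 : E) 1), Set.EqOn (fun r : ℝ => r ^ (finrank ℝ E - 1) •
      (‖r • (σ : E)‖ ^ (finrank ℝ E - 1))⁻¹ • h' (r • (σ : E))) (fun r => h' (r • (σ : E)))
      (Set.Ioi 0) := fun σ r hr => by
    have hr0 : r ^ (finrank ℝ E - 1) ≠ 0 := pow_ne_zero _ (ne_of_gt hr)
    simp only [norm_smul, norm_eq_of_mem_sphere, mul_one, Real.norm_of_nonneg (le_of_lt hr)]
    rw [smul_smul, mul_inv_cancel₀ hr0, one_smul]
  have hrayIntegral : ∀ᵐ σ : Metric.sphere (0 : E) 1 ∂μ.toSphere, ∫ r in Set.Ioi (0 : ℝ),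
      r ^ (finrank ℝ E - 1) • (‖r • (σ : E)‖ ^ (finrank ℝ E - 1))⁻¹ • h' (r • (σ : E)) =
        -h 0 := by
    filter_upwards [ae_toSphere_integrableOn_Ioi hint] with σ hσ
    have hlim : Tendsto (fun r : ℝ => h (r • (σ : E))) atTop (𝓝 0) := by
      refine hsupp.is_zero_at_infty.comp ?_
      rw [← Metric.cobounded_eq_cocompact, ← tendsto_norm_atTop_iff_cobounded]
      simpa [norm_smul] using tendsto_abs_atTop_atTop
    have hray0 : ContinuousWithinAt (fun r : ℝ => h (r • (σ : E))) (Set.Ici 0) 0 := by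
      refine ContinuousAt.continuousWithinAt (ContinuousAt.comp ?_ (by fun_prop))
      simpa using hcont
    have hderivRay : ∀ r ∈ Set.Ioi (0 : ℝ),
        HasDerivAt (fun r : ℝ => h (r • (σ : E))) (h' (r • (σ : E))) r := fun r hr => by
      have hr0 : (0 : ℝ) < r := hr
      have hdir : ‖r • (σ : E)‖⁻¹ • r • (σ : E) = σ := by
        rw [norm_smul, norm_eq_of_mem_sphere, mul_one, Real.norm_of_nonneg hr0.le, smul_smul,
          inv_mul_cancel₀ hr0.ne', one_smul]
      have hσ0 : (σ : E) ≠ 0 := ne_zero_of_mem_unit_sphere σ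
      have hline := (hderiv _ (smul_ne_zero hr0.ne' hσ0)).scomp_of_eq r
        ((hasDerivAt_id r).sub_const r) (by simp)
      simpa [Function.comp_def, hdir, ← add_smul] using hline
    rw [setIntegral_congr_fun measurableSet_Ioi (hray σ), integral_Ioi_of_hasDerivAt_of_tendsto
      hray0 hderivRay (hσ.congr_fun (hray σ) measurableSet_Ioi) hlim, zero_smul, zero_sub]
  rw [integral_eq_integral_toSphere hint, integral_congr_ae hrayIntegral, integral_const,
    smul_neg]

end PolarCoordinates

section PartialDerivatives

variable {f : E3 → ℂ} {x : E3}

theorem contDiffOn_pderiv3 (hf : ContDiffOn ℝ ∞ f {0}ᶜ) (i : Fin 3) :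
    ContDiffOn ℝ ∞ (pderiv3 i f) {0}ᶜ :=
  (hf.fderiv_of_isOpen isOpen_compl_singleton (m := ∞) (by simp)).clm_apply contDiffOn_const

theorem contDiff_pderiv3 (hf : ContDiff ℝ ∞ f) (i : Fin 3) : ContDiff ℝ ∞ (pderiv3 i f) :=
  (hf.fderiv_right (m := ∞) (by simp)).clm_apply contDiff_const

theorem differentiableAt_of_contDiffOn_compl_zero (hf : ContDiffOn ℝ ∞ f {0}ᶜ) (hx : x ≠ 0) :
    DifferentiableAt ℝ f x :=
  (hf.contDiffAt (isOpen_compl_singleton.mem_nhds hx)).differentiableAt (by simp)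

theorem pderiv3_comm (hf : ContDiffAt ℝ 2 f x) (i j : Fin 3) :
    pderiv3 i (pderiv3 j f) x = pderiv3 j (pderiv3 i f) x := by
  have hdiff : DifferentiableAt ℝ (fderiv ℝ f) x :=
    (hf.fderiv_right (m := 1) (by norm_num)).differentiableAt one_ne_zero
  have hsecond : ∀ k l : Fin 3, pderiv3 k (pderiv3 l f) x =
      fderiv ℝ (fderiv ℝ f) x (EuclideanSpace.single k 1) (EuclideanSpace.single l 1) := by
    intro k l
    have h : HasFDerivAt (pderiv3 l f) _ x :=
      hdiff.hasFDerivAt.clm_apply (hasFDerivAt_const (EuclideanSpace.single l (1 : ℝ)) x)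
    rw [pderiv3, h.fderiv]
    simp
  rw [hsecond, hsecond]
  exact hf.isSymmSndFDerivAt (by simp) _ _

theorem pderiv3_congr {g : E3 → ℂ} (h : Set.EqOn f g {0}ᶜ) (hx : x ≠ 0) (i : Fin 3) :
    pderiv3 i f x = pderiv3 i g x := by
  rw [pderiv3, pderiv3, (h.eventuallyEq_of_mem (isOpen_compl_singleton.mem_nhds hx)).fderiv_eq]

theorem pderiv3_add {g : E3 → ℂ} (hf : DifferentiableAt ℝ f x) (hg : DifferentiableAt ℝ g x)
    (i : Fin 3) : pderiv3 i (fun y => f y + g y) x = pderiv3 i f x + pderiv3 i g x := by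
  rw [pderiv3, (hf.hasFDerivAt.fun_add hg.hasFDerivAt).fderiv]
  rfl

theorem pderiv3_const_mul (hf : DifferentiableAt ℝ f x) (c : ℂ) (i : Fin 3) :
    pderiv3 i (fun y => c * f y) x = c * pderiv3 i f x := by
  rw [pderiv3, (hf.hasFDerivAt.const_mul c).fderiv]
  rfl

theorem pderiv3_sum {ι : Type*} {s : Finset ι} {g : ι → E3 → ℂ}
    (hg : ∀ k ∈ s, DifferentiableAt ℝ (g k) x) (i : Fin 3) :
    pderiv3 i (fun y => ∑ k ∈ s, g k y) x = ∑ k ∈ s, pderiv3 i (g k) x := by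
  rw [pderiv3, (HasFDerivAt.fun_sum fun k hk => (hg k hk).hasFDerivAt).fderiv]
  simp [pderiv3]

theorem fderiv_apply_eq_sum_pderiv3 (f : E3 → ℂ) (x v : E3) :
    fderiv ℝ f x v = ∑ i, (v i : ℂ) * pderiv3 i f x := by
  have hv : v = ∑ i, v i • EuclideanSpace.single i (1 : ℝ) := by
    simpa using ((EuclideanSpace.basisFun (Fin 3) ℝ).sum_repr v).symm
  conv_lhs => rw [hv]
  simp [pderiv3, Complex.real_smul]

theorem quadOp_one (f : E3 → ℂ) (x : E3) :
    quadOp 1 f x = ∑ i, pderiv3 i (pderiv3 i f) x := by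
  simp [quadOp, Matrix.one_apply]

theorem quadOp_smul (m : ℂ) (q : Matrix (Fin 3) (Fin 3) ℂ) (f : E3 → ℂ) (x : E3) :
    quadOp (m • q) f x = m * quadOp q f x := by
  simp [quadOp, Finset.mul_sum, mul_assoc]

theorem vecD1_eq_one : vecD1 = 1 := by
  ext i j
  fin_cases i <;> fin_cases j <;> rfl

theorem toC_normSqM_vecD1 : toC (normSqM vecD1) = 1 := by
  ext i j
  simp [toC, normSqM, tensorSq, vecD1_eq_one, Matrix.sum_apply, Matrix.one_apply,
    apply_ite Complex.ofReal, eq_comm]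

theorem quadOp_tensorSq_vecD1 (a b : Fin 3) (f : E3 → ℂ) (x : E3) :
    quadOp (toC (tensorSq vecD1 a b)) f x = pderiv3 a (pderiv3 b f) x := by
  simp [quadOp, toC, tensorSq, vecD1_eq_one, Matrix.one_apply, apply_ite Complex.ofReal]

theorem quadSymbol_normSqM_vecD1 (n : E3) : quadSymbol (normSqM vecD1) n = ‖n‖ ^ 2 := by
  rw [EuclideanSpace.norm_sq_eq]
  simp [quadSymbol, normSqM, tensorSq, vecD1_eq_one, Matrix.sum_apply, Matrix.one_apply, ← sq]

end PartialDerivatives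

/-- A smooth compactly supported function on `ℝ³`, against which distributions are tested. -/
structure IsTestFunction (φ : E3 → ℂ) : Prop where
  contDiff : ContDiff ℝ ∞ φ
  hasCompactSupport : HasCompactSupport φ

namespace IsTestFunction

variable {u φ ψ : E3 → ℂ}

theorem pderiv3 (hφ : IsTestFunction φ) (i : Fin 3) : IsTestFunction (pderiv3 i φ) :=
  ⟨contDiff_pderiv3 hφ.contDiff i, hφ.hasCompactSupport.fderiv_apply ℝ _⟩

theorem const_mul (hφ : IsTestFunction φ) (c : ℂ) : IsTestFunction fun x => c * φ x :=
  ⟨contDiff_const.mul hφ.contDiff, hφ.hasCompactSupport.mul_left⟩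

theorem add (hφ : IsTestFunction φ) (hψ : IsTestFunction ψ) :
    IsTestFunction fun x => φ x + ψ x :=
  ⟨hφ.contDiff.add hψ.contDiff, hφ.hasCompactSupport.add hψ.hasCompactSupport⟩

theorem zero : IsTestFunction 0 :=
  ⟨contDiff_const, HasCompactSupport.zero⟩

theorem quadOp (hφ : IsTestFunction φ) (q : Matrix (Fin 3) (Fin 3) ℂ) :
    IsTestFunction (quadOp q φ) := by
  have h : _root_.quadOp q φ =
      ∑ j, ∑ k, fun x => q j k * _root_.pderiv3 j (_root_.pderiv3 k φ) x := by
    ext x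
    simp only [_root_.quadOp, Finset.sum_apply]
  rw [h]
  exact Finset.sum_induction _ _ (fun _ _ => add) zero fun j _ =>
    Finset.sum_induction _ _ (fun _ _ => add) zero fun k _ =>
      ((hφ.pderiv3 k).pderiv3 j).const_mul (q j k)

theorem integrable_mul (hφ : IsTestFunction φ) (hu : LocallyIntegrable u) :
    Integrable fun x => u x * φ x := by
  simpa only [smul_eq_mul] using
    hu.integrable_smul_right_of_hasCompactSupport hφ.contDiff.continuous hφ.hasCompactSupport

end IsTestFunction

theorem integral_mul_pderiv3_eq_neg {u φ : E3 → ℂ} {i : Fin 3}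
    (hu : ∀ x ≠ 0, DifferentiableAt ℝ u x) (hint : LocallyIntegrable u)
    (hint' : LocallyIntegrable (pderiv3 i u)) (hφ : IsTestFunction φ) :
    ∫ x, u x * pderiv3 i φ x = -∫ x, pderiv3 i u x * φ x := by
  have hu' := hφ.integrable_mul hint'
  have hφ' := (hφ.pderiv3 i).integrable_mul hint
  have hzero : ∫ x, (pderiv3 i u x * φ x + u x * pderiv3 i φ x) = 0 :=
    integral_eq_zero_of_hasLineDerivAt_compl_zero (by simp) (hφ.integrable_mul hint)
      (hu'.add hφ') fun x hx => by
        have hφx : DifferentiableAt ℝ φ x := hφ.contDiff.differentiable (by simp) x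
        simpa [pderiv3, add_comm, mul_comm, Pi.mul_def] using
          ((hu x hx).hasFDerivAt.mul hφx.hasFDerivAt).hasLineDerivAt (EuclideanSpace.single i 1)
  rw [integral_add hu' hφ'] at hzero
  exact eq_neg_of_add_eq_zero_right hzero

section RadialFunctions

theorem hasFDerivAt_norm_of_ne_zero {E : Type*} [NormedAddCommGroup E] [InnerProductSpace ℝ E]
    {x : E} (hx : x ≠ 0) : HasFDerivAt (fun y : E => ‖y‖) (‖x‖⁻¹ • innerSL ℝ x) x := by
  have h := (hasStrictFDerivAt_norm_sq x).hasFDerivAt.sqrt (by simpa using hx)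
  simp only [Real.sqrt_sq (norm_nonneg _)] at h
  refine h.congr_fderiv ?_
  ext v
  simp only [smul_apply, innerSL_apply_apply, smul_eq_mul, nsmul_eq_mul, Nat.cast_ofNat]
  ring

theorem hasFDerivAt_comp_norm {E G : Type*} [NormedAddCommGroup E] [InnerProductSpace ℝ E]
    [NormedAddCommGroup G] [NormedSpace ℝ G] {u : ℝ → G} {u' : G} {x : E} (hx : x ≠ 0)
    (hu : HasDerivAt u u' ‖x‖) :
    HasFDerivAt (fun y => u ‖y‖) ((‖x‖⁻¹ • innerSL ℝ x).smulRight u') x := by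
  refine (hu.hasFDerivAt.comp x (hasFDerivAt_norm_of_ne_zero hx)).congr_fderiv ?_
  ext v
  simp [mul_smul]

theorem hasLineDerivAt_comp_norm_mul {E : Type*} [NormedAddCommGroup E] [InnerProductSpace ℝ E]
    {F : ℝ → ℂ} {w : ℂ} {φ : E → ℂ} {x : E} (hx : x ≠ 0) (hF : HasDerivAt F w ‖x‖)
    (hφ : DifferentiableAt ℝ φ x) :
    HasLineDerivAt ℝ (fun y => F ‖y‖ * φ y) (w * φ x + F ‖x‖ * fderiv ℝ φ x (‖x‖⁻¹ • x)) x
      (‖x‖⁻¹ • x) := by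
  have hrc : (‖x‖ : ℂ) ≠ 0 := by simpa using hx
  convert ((hasFDerivAt_comp_norm hx hF).fun_mul hφ.hasFDerivAt).hasLineDerivAt (‖x‖⁻¹ • x) using 1
  simp only [add_apply, smul_apply, smul_eq_mul, ContinuousLinearMap.smulRight_apply,
    innerSL_apply_apply, inner_smul_right, real_inner_self_eq_norm_sq, Complex.real_smul]
  push_cast
  field_simp
  ring

theorem ofReal_norm_ne_zero {x : E3} (hx : x ≠ 0) : (‖x‖ : ℂ) ≠ 0 := by
  simpa using hx

theorem sum_ofReal_sq (x : E3) : ∑ i, (x i : ℂ) ^ 2 = (‖x‖ : ℂ) ^ 2 := by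
  rw [← Complex.ofReal_pow ‖x‖, EuclideanSpace.norm_sq_eq]
  simp

theorem norm_ofReal_apply_div_norm_le_one (x : E3) (i : Fin 3) : ‖(x i : ℂ) / ‖x‖‖ ≤ 1 := by
  rw [norm_div, Complex.norm_real, Complex.norm_real, norm_norm]
  exact div_le_one_of_le₀ (PiLp.norm_apply_le x i) (norm_nonneg x)

theorem norm_one_apply_sub_three_mul_le_four {ι : Type*} [DecidableEq ι] {z : ℂ} (hz : ‖z‖ ≤ 1)
    (i j : ι) : ‖(1 : Matrix ι ι ℂ) i j - 3 * z‖ ≤ 4 := by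
  have hone : ‖(1 : Matrix ι ι ℂ) i j‖ ≤ 1 := by
    rw [Matrix.one_apply]
    split_ifs <;> simp
  refine (norm_sub_le _ _).trans ?_
  rw [norm_mul, Complex.norm_ofNat]
  linarith

theorem pderiv3_mul {f g : E3 → ℂ} {x : E3} (hf : DifferentiableAt ℝ f x)
    (hg : DifferentiableAt ℝ g x) (i : Fin 3) :
    pderiv3 i (fun y => f y * g y) x = pderiv3 i f x * g x + f x * pderiv3 i g x := by
  rw [pderiv3, (hf.hasFDerivAt.fun_mul hg.hasFDerivAt).fderiv]
  simp only [add_apply, smul_apply, smul_eq_mul, pderiv3]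
  ring

theorem pderiv3_comp_norm {u : ℝ → ℂ} {u' : ℂ} {x : E3} (hx : x ≠ 0)
    (hu : HasDerivAt u u' ‖x‖) (i : Fin 3) :
    pderiv3 i (fun y => u ‖y‖) x = u' * (x i / ‖x‖) := by
  rw [pderiv3, (hasFDerivAt_comp_norm hx hu).fderiv]
  simp only [ContinuousLinearMap.smulRight_apply, smul_apply, innerSL_apply_apply,
    EuclideanSpace.inner_single_right, one_mul, conj_trivial, smul_eq_mul, Complex.real_smul]
  push_cast
  ring

theorem pderiv3_ofReal_apply (i j : Fin 3) (x : E3) :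
    pderiv3 i (fun y => (y j : ℂ)) x = (1 : Matrix (Fin 3) (Fin 3) ℂ) i j := by
  have h : HasFDerivAt (fun y : E3 => (y j : ℂ))
      (Complex.ofRealCLM.comp (EuclideanSpace.proj j : E3 →L[ℝ] ℝ)) x :=
    (Complex.ofRealCLM.comp (EuclideanSpace.proj j : E3 →L[ℝ] ℝ)).hasFDerivAt
  rw [pderiv3, h.fderiv]
  simp [Matrix.one_apply, PiLp.single_apply, eq_comm, apply_ite Complex.ofReal]

theorem toSphere_real_univ_E3 : (volume : Measure E3).toSphere.real Set.univ = 4 * Real.pi := by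
  rw [Measure.toSphere_real_apply_univ, measureReal_def, EuclideanSpace.volume_ball_fin_three,
    ENNReal.ofReal_one, one_pow, one_mul, ENNReal.toReal_ofReal (by positivity),
    finrank_euclideanSpace, Fintype.card_fin]
  push_cast
  ring

/-- `f` has radial flux `F` when `∇f = F(r) r⁻³ x` for `x ≠ 0`, so that `4π F(r)` is the flux of
`∇f` through the sphere of radius `r`. For a radial function `f = u(r)` this is `F = r² u'`. -/
def HasRadialFlux (f : E3 → ℂ) (F : ℝ → ℂ) : Prop :=
  ∀ x ≠ 0, ∀ i, pderiv3 i f x = F ‖x‖ / ‖x‖ ^ 3 * x i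

theorem hasRadialFlux_of_eqOn_comp_norm {f : E3 → ℂ} {u F : ℝ → ℂ}
    (hf : Set.EqOn f (fun x => u ‖x‖) {0}ᶜ)
    (hu : ∀ r > 0, HasDerivAt u (F r / (r : ℂ) ^ 2) r) : HasRadialFlux f F := fun x hx i => by
  have := ofReal_norm_ne_zero hx
  rw [pderiv3_congr hf hx, pderiv3_comp_norm hx (hu _ (norm_pos_iff.2 hx))]
  field_simp

theorem locallyIntegrable_comp_norm_div_norm_sq {w : ℝ → ℂ} (hw : Continuous w) :
    LocallyIntegrable fun x : E3 => w ‖x‖ / ‖x‖ ^ 2 := by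
  refine locallyIntegrable_of_norm_pow_mul_norm_le (n := 2) (C := fun r => ‖w r‖) (by simp)
    (.div (by fun_prop) (by fun_prop) fun x hx => pow_ne_zero 2 (ofReal_norm_ne_zero hx))
    hw.norm fun x hx => ?_
  rw [norm_div, norm_pow, Complex.norm_real, norm_norm, mul_div_cancel₀]
  exact pow_ne_zero 2 (norm_ne_zero_iff.2 hx)

namespace HasRadialFlux

variable {f φ : E3 → ℂ} {F F' : ℝ → ℂ}

theorem pderiv3_pderiv3 (h : HasRadialFlux f F) {w : ℂ} {x : E3} (hx : x ≠ 0)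
    (hF : HasDerivAt F w ‖x‖) (i j : Fin 3) :
    pderiv3 i (pderiv3 j f) x = w / ‖x‖ ^ 2 * (x i / ‖x‖ * (x j / ‖x‖)) +
      F ‖x‖ / ‖x‖ ^ 3 *
        ((1 : Matrix (Fin 3) (Fin 3) ℂ) i j - 3 * (x i / ‖x‖ * (x j / ‖x‖))) := by
  have hr := ofReal_norm_ne_zero hx
  have hslope : HasDerivAt (fun r : ℝ => F r / (r : ℂ) ^ 3)
      (w / ‖x‖ ^ 3 - 3 * F ‖x‖ / ‖x‖ ^ 4) ‖x‖ := by
    refine (hF.fun_div ((Complex.ofRealCLM.hasDerivAt (x := ‖x‖)).fun_pow 3)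
      (pow_ne_zero 3 hr)).congr_deriv ?_
    simp only [Complex.ofRealCLM_apply, Complex.ofReal_one]
    field_simp
    push_cast
    ring
  have hcoord : DifferentiableAt ℝ (fun y : E3 => (y j : ℂ)) x := by fun_prop
  rw [pderiv3_congr (g := fun y => F ‖y‖ / ‖y‖ ^ 3 * y j) (fun y hy => h y hy j) hx,
    pderiv3_mul (hasFDerivAt_comp_norm hx hslope).differentiableAt hcoord,
    pderiv3_comp_norm hx hslope, pderiv3_ofReal_apply]
  field_simp
  ring

theorem quadOp_one (h : HasRadialFlux f F) {w : ℂ} {x : E3} (hx : x ≠ 0)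
    (hF : HasDerivAt F w ‖x‖) : quadOp 1 f x = w / ‖x‖ ^ 2 := by
  have hr := ofReal_norm_ne_zero hx
  have hunit : ∑ i, (x i / ‖x‖ * (x i / ‖x‖) : ℂ) = 1 := by
    simp only [← sq, div_pow]
    rw [← Finset.sum_div, sum_ofReal_sq, div_self (pow_ne_zero 2 hr)]
  simp only [_root_.quadOp_one, h.pderiv3_pderiv3 hx hF, Matrix.one_apply_eq,
    Finset.sum_add_distrib, ← Finset.mul_sum, Finset.sum_sub_distrib, hunit]
  simp

theorem locallyIntegrable_pderiv3 (h : HasRadialFlux f F) (hF : Continuous F) (i : Fin 3) :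
    LocallyIntegrable (pderiv3 i f) := by
  have hcont : ContinuousOn (fun x : E3 => F ‖x‖ / ‖x‖ ^ 3 * x i) {0}ᶜ :=
    ContinuousOn.mul (.div (by fun_prop) (by fun_prop) fun x hx =>
      pow_ne_zero 3 (ofReal_norm_ne_zero hx)) (by fun_prop)
  refine locallyIntegrable_of_norm_pow_mul_norm_le (n := 2) (C := fun r => ‖F r‖) (by simp)
    (hcont.congr fun x hx => h x hx i) hF.norm fun x hx => ?_
  have hr : (‖x‖ : ℂ) ≠ 0 := ofReal_norm_ne_zero hx
  calc ‖x‖ ^ 2 * ‖pderiv3 i f x‖ = ‖(‖x‖ : ℂ) ^ 2 * pderiv3 i f x‖ := by simp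
    _ = ‖F ‖x‖ * (x i / ‖x‖)‖ := by rw [h x hx]; congr 1; field_simp
    _ ≤ ‖F ‖x‖‖ := by
        rw [norm_mul]
        exact mul_le_of_le_one_right (norm_nonneg _) (norm_ofReal_apply_div_norm_le_one x i)

theorem locallyIntegrable_pderiv3_pderiv3 (h : HasRadialFlux f F)
    (hF : ∀ r, HasDerivAt F (F' r) r) (hF' : Continuous F') (hF0 : F 0 = 0) (i j : Fin 3) :
    LocallyIntegrable (pderiv3 i (pderiv3 j f)) := by
  have hFc : Continuous F := continuous_iff_continuousAt.2 fun r => (hF r).continuousAt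
  have hslope : Continuous (dslope F 0) := continuousOn_univ.1 <|
    (continuousOn_dslope univ_mem).2 ⟨hFc.continuousOn, (hF 0).differentiableAt⟩
  have hFslope : ∀ r : ℝ, F r = r * dslope F 0 r := fun r => by
    simpa [hF0] using (sub_smul_dslope F 0 r).symm
  have hcont : ContinuousOn (fun x : E3 => F' ‖x‖ / ‖x‖ ^ 2 * (x i / ‖x‖ * (x j / ‖x‖)) +
      F ‖x‖ / ‖x‖ ^ 3 *
        ((1 : Matrix (Fin 3) (Fin 3) ℂ) i j - 3 * (x i / ‖x‖ * (x j / ‖x‖)))) {0}ᶜ := by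
    fun_prop (disch := simp)
  refine locallyIntegrable_of_norm_pow_mul_norm_le (n := 2)
    (C := fun r => ‖F' r‖ + ‖dslope F 0 r‖ * 4) (by simp)
    (hcont.congr fun x hx => h.pderiv3_pderiv3 hx (hF _) i j) (by fun_prop) fun x hx => ?_
  have hr : (‖x‖ : ℂ) ≠ 0 := ofReal_norm_ne_zero hx
  have hunit : ‖(x i / ‖x‖ * (x j / ‖x‖) : ℂ)‖ ≤ 1 := by
    rw [norm_mul]
    exact mul_le_one₀ (norm_ofReal_apply_div_norm_le_one x i) (norm_nonneg _)
      (norm_ofReal_apply_div_norm_le_one x j)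
  have htraceless := norm_one_apply_sub_three_mul_le_four hunit i j
  calc ‖x‖ ^ 2 * ‖pderiv3 i (pderiv3 j f) x‖
      = ‖(‖x‖ : ℂ) ^ 2 * pderiv3 i (pderiv3 j f) x‖ := by simp
    _ = ‖F' ‖x‖ * (x i / ‖x‖ * (x j / ‖x‖)) + dslope F 0 ‖x‖ *
          ((1 : Matrix (Fin 3) (Fin 3) ℂ) i j - 3 * (x i / ‖x‖ * (x j / ‖x‖)))‖ := by
        rw [h.pderiv3_pderiv3 hx (hF _), hFslope ‖x‖]
        congr 1
        field_simp
    _ ≤ ‖F' ‖x‖‖ * 1 + ‖dslope F 0 ‖x‖‖ * 4 :=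
        (norm_add_le _ _).trans (add_le_add
          ((norm_mul_le _ _).trans (mul_le_mul_of_nonneg_left hunit (norm_nonneg _)))
          ((norm_mul_le _ _).trans (mul_le_mul_of_nonneg_left htraceless (norm_nonneg _))))
    _ = ‖F' ‖x‖‖ + ‖dslope F 0 ‖x‖‖ * 4 := by rw [mul_one]

theorem sum_pderiv3_mul_pderiv3 (h : HasRadialFlux f F) (φ : E3 → ℂ) {x : E3} (hx : x ≠ 0) :
    ∑ i, pderiv3 i f x * pderiv3 i φ x =
      F ‖x‖ / ‖x‖ ^ 2 * fderiv ℝ φ x (‖x‖⁻¹ • x) := by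
  have hr := ofReal_norm_ne_zero hx
  rw [fderiv_apply_eq_sum_pderiv3, Finset.mul_sum]
  refine Finset.sum_congr rfl fun i _ => ?_
  rw [h x hx]
  simp only [PiLp.smul_apply, smul_eq_mul]
  push_cast
  field_simp

theorem integral_mul_quadOp_one_eq_neg (h : HasRadialFlux f F)
    (hfdiff : ∀ x ≠ 0, DifferentiableAt ℝ f x) (hf : LocallyIntegrable f) (hF : Continuous F)
    (hφ : IsTestFunction φ) :
    ∫ x, f x * quadOp 1 φ x = -∫ x, ∑ i, pderiv3 i f x * pderiv3 i φ x := by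
  have hgrad := h.locallyIntegrable_pderiv3 hF
  simp only [_root_.quadOp_one, Finset.mul_sum]
  rw [integral_finsetSum _ fun i _ => ((hφ.pderiv3 i).pderiv3 i).integrable_mul hf,
    integral_finsetSum _ fun i _ => (hφ.pderiv3 i).integrable_mul (hgrad i),
    ← Finset.sum_neg_distrib]
  exact Finset.sum_congr rfl fun i _ =>
    integral_mul_pderiv3_eq_neg hfdiff hf (hgrad i) (hφ.pderiv3 i)

theorem integral_mul_quadOp_one (h : HasRadialFlux f F) (hfdiff : ∀ x ≠ 0, DifferentiableAt ℝ f x)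
    (hf : LocallyIntegrable f) (hF : ∀ r, HasDerivAt F (F' r) r) (hF' : Continuous F')
    (hφ : IsTestFunction φ) :
    ∫ x, f x * quadOp 1 φ x = (∫ x : E3, F' ‖x‖ / ‖x‖ ^ 2 * φ x) + 4 * Real.pi * F 0 * φ 0 := by
  have hFc : Continuous F := continuous_iff_continuousAt.2 fun r => (hF r).continuousAt
  have hsource : Integrable fun x : E3 => F' ‖x‖ / ‖x‖ ^ 2 * φ x :=
    hφ.integrable_mul (locallyIntegrable_comp_norm_div_norm_sq hF')
  have hdot : Integrable fun x => ∑ i, pderiv3 i f x * pderiv3 i φ x :=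
    integrable_finsetSum _ fun i _ =>
      (hφ.pderiv3 i).integrable_mul (h.locallyIntegrable_pderiv3 hFc i)
  have hsplit : (fun x : E3 => (‖x‖ ^ (Module.finrank ℝ E3 - 1))⁻¹ •
      (F' ‖x‖ * φ x + F ‖x‖ * fderiv ℝ φ x (‖x‖⁻¹ • x))) =ᵐ[volume]
      fun x => F' ‖x‖ / ‖x‖ ^ 2 * φ x + ∑ i, pderiv3 i f x * pderiv3 i φ x := by
    filter_upwards [Measure.ae_ne volume 0] with x hx
    rw [h.sum_pderiv3_mul_pderiv3 φ hx, finrank_euclideanSpace, Fintype.card_fin,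
      Complex.real_smul]
    push_cast
    ring
  have hflux := integral_inv_norm_pow_smul_radial_deriv (μ := volume)
    (h := fun x : E3 => F ‖x‖ * φ x)
    ((hFc.comp continuous_norm).mul hφ.contDiff.continuous).continuousAt
    hφ.hasCompactSupport.mul_left
    (fun x hx => hasLineDerivAt_comp_norm_mul hx (hF _)
      (hφ.contDiff.differentiable (by simp) x))
    ((hsource.add hdot).congr hsplit.symm)
  rw [integral_congr_ae hsplit, integral_add hsource hdot, toSphere_real_univ_E3, norm_zero,
    Complex.real_smul] at hflux
  rw [h.integral_mul_quadOp_one_eq_neg hfdiff hf hFc hφ]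
  push_cast at hflux
  linear_combination -hflux

end HasRadialFlux

end RadialFunctions

section RadialPotential

/-- The source `∫₀ʳ s e(s) ds = ∫₀ʳ s² (e(s)/s) ds` that a radial density `e(s)/s` places, per unit
solid angle, in the ball of radius `r`. -/
noncomputable def enclosedSource (e : ℝ → ℂ) (r : ℝ) : ℂ := ∫ s in (0 : ℝ)..r, s * e s

variable {e : ℝ → ℂ}

theorem contDiff_euclideanSpace_single {ι : Type*} [Fintype ι] [DecidableEq ι] {n : WithTop ℕ∞}
    (i : ι) : ContDiff ℝ n fun r : ℝ => EuclideanSpace.single i r :=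
  contDiff_euclidean.2 fun j => by
    simp only [PiLp.single_apply]
    split_ifs
    exacts [contDiff_id, contDiff_const]

@[simp] theorem enclosedSource_zero : enclosedSource e 0 = 0 := intervalIntegral.integral_same

theorem hasDerivAt_enclosedSource (he : Continuous e) (r : ℝ) :
    HasDerivAt (enclosedSource e) (r * e r) r :=
  (Complex.continuous_ofReal.mul he).integral_hasStrictDerivAt 0 r |>.hasDerivAt

theorem enclosedSource_const_mul_sub_const_mul {e₀ e₁ : ℝ → ℂ} (he₀ : Continuous e₀)
    (he₁ : Continuous e₁) (α₀ α₁ : ℂ) (r : ℝ) :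
    enclosedSource (fun s => α₀ * e₀ s - α₁ * e₁ s) r =
      α₀ * enclosedSource e₀ r - α₁ * enclosedSource e₁ r := by
  have hint : ∀ {e : ℝ → ℂ}, Continuous e → ∀ α : ℂ,
      IntervalIntegrable (fun s : ℝ => α * (s * e s)) volume 0 r := fun he α =>
    (continuous_const.mul (Complex.continuous_ofReal.mul he)).intervalIntegrable _ _
  simp only [enclosedSource, ← intervalIntegral.integral_const_mul]
  rw [← intervalIntegral.integral_sub (hint he₀ α₀) (hint he₁ α₁)]
  congr with s
  ring

theorem contDiff_enclosedSource (he : ContDiff ℝ ∞ e) : ContDiff ℝ ∞ (enclosedSource e) := by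
  have hderiv := hasDerivAt_enclosedSource he.continuous
  rw [contDiff_infty_iff_deriv, funext fun r => (hderiv r).deriv]
  exact ⟨fun r => (hderiv r).differentiableAt, Complex.ofRealCLM.contDiff.mul he⟩

theorem exists_norm_enclosedSource_le (he : Continuous e) :
    ∃ C, ∀ r ∈ Set.Icc (0 : ℝ) 1, ‖enclosedSource e r‖ ≤ C * r ^ 2 := by
  obtain ⟨C, hC⟩ := isCompact_Icc.exists_bound_of_continuousOn (s := Set.Icc (0 : ℝ) 1)
    he.continuousOn
  refine ⟨C, fun r hr => ?_⟩
  have hle : ∀ s ∈ Set.uIoc 0 r, ‖(s : ℂ) * e s‖ ≤ r * C := fun s hs => by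
    rw [Set.uIoc_of_le hr.1] at hs
    rw [norm_mul, Complex.norm_real, Real.norm_of_nonneg hs.1.le]
    exact mul_le_mul hs.2 (hC s ⟨hs.1.le, hs.2.trans hr.2⟩) (norm_nonneg _) hr.1
  calc ‖enclosedSource e r‖ ≤ r * C * |r - 0| :=
        intervalIntegral.norm_integral_le_of_norm_le_const hle
    _ = C * r ^ 2 := by rw [sub_zero, abs_of_nonneg hr.1]; ring

theorem isPotential_integral_enclosedSource (he : ContDiff ℝ ∞ e) :
    IsPotential (normSqM vecD1) (fun x => e ‖x‖ / ‖x‖)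
      fun x => ∫ s in (1 : ℝ)..‖x‖, enclosedSource e s / s ^ 2 := by
  set u : ℝ → ℂ := fun r => ∫ s in (1 : ℝ)..r, enclosedSource e s / s ^ 2
  have hslope : ContDiffOn ℝ ∞ (fun s : ℝ => enclosedSource e s / (s : ℂ) ^ 2) (Set.Ioi 0) :=
    ((contDiff_enclosedSource he).contDiffOn.mul <|
      (Complex.ofRealCLM.contDiff.pow 2).contDiffOn.inv fun s hs =>
        pow_ne_zero 2 (Complex.ofReal_ne_zero.2 (ne_of_gt hs))).congr fun s _ => div_eq_mul_inv _ _
  have hu : ∀ r > 0, HasDerivAt u (enclosedSource e r / (r : ℂ) ^ 2) r := fun r hr =>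
    intervalIntegral.integral_hasDerivAt_right
      ((hslope.continuousOn.mono fun s hs =>
        (lt_min one_pos hr).trans_le hs.1).intervalIntegrable)
      (hslope.continuousOn.stronglyMeasurableAtFilter isOpen_Ioi r hr)
      (hslope.continuousOn.continuousAt (Ioi_mem_nhds hr))
  have husm : ContDiffOn ℝ ∞ u (Set.Ioi 0) :=
    (contDiffOn_infty_iff_deriv_of_isOpen isOpen_Ioi).2
      ⟨fun r hr => (hu r hr).differentiableAt.differentiableWithinAt,
        hslope.congr fun r hr => (hu r hr).deriv⟩
  refine ⟨husm.comp (contDiffOn_id.norm ℝ fun x hx => hx) fun x hx => norm_pos_iff.2 hx,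
    fun x hx => ?_, ?_, fun U _ _ x => by simp only [U.norm_map]⟩
  · have hr := ofReal_norm_ne_zero hx
    rw [toC_normSqM_vecD1, (hasRadialFlux_of_eqOn_comp_norm (fun _ _ => rfl) hu).quadOp_one hx
      (hasDerivAt_enclosedSource he.continuous _)]
    field_simp
  · obtain ⟨C, hC⟩ := exists_norm_enclosedSource_le he.continuous
    refine ⟨C, ?_⟩
    filter_upwards [self_mem_nhdsWithin,
      nhdsWithin_le_nhds (Metric.closedBall_mem_nhds (0 : E3) one_pos)] with x hx hx1
    have hr : 0 < ‖x‖ := norm_pos_iff.2 hx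
    rw [(hasFDerivAt_comp_norm hx (hu _ hr)).fderiv, ContinuousLinearMap.norm_smulRight_apply,
      norm_smul, innerSL_apply_norm, norm_inv, norm_norm, inv_mul_cancel₀ hr.ne', one_mul,
      norm_div, norm_pow, Complex.norm_real, norm_norm, div_le_iff₀ (by positivity)]
    exact hC _ ⟨hr.le, mem_closedBall_zero_iff.1 hx1⟩

theorem HasRadialFlux.tendsto_zero {f : E3 → ℂ} {F : ℝ → ℂ} (h : HasRadialFlux f F) {B : ℝ}
    (hB : ∀ᶠ x in 𝓝[≠] (0 : E3), ‖fderiv ℝ f x‖ ≤ B) : Tendsto F (𝓝[>] 0) (𝓝 0) := by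
  have hray : Tendsto (fun r : ℝ => EuclideanSpace.single (0 : Fin 3) r) (𝓝[>] 0) (𝓝[≠] 0) := by
    refine tendsto_nhdsWithin_iff.2 ⟨?_, eventually_mem_nhdsWithin.mono fun r hr => ?_⟩
    · have hzero : EuclideanSpace.single (0 : Fin 3) (0 : ℝ) = 0 := by simp
      rw [← hzero]
      exact (contDiff_euclideanSpace_single (n := 0) 0).continuous.continuousAt.mono_left
        nhdsWithin_le_nhds
    · simpa using (ne_of_gt hr : r ≠ 0)
  have hbound : ∀ᶠ r : ℝ in 𝓝[>] 0, ‖F r‖ ≤ B * r ^ 2 := by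
    filter_upwards [hray.eventually hB, self_mem_nhdsWithin] with r hr (hr0 : 0 < r)
    have hrc : (r : ℂ) ≠ 0 := Complex.ofReal_ne_zero.2 hr0.ne'
    have hflux : F r = pderiv3 0 f (EuclideanSpace.single 0 r) * (r : ℂ) ^ 2 := by
      rw [h _ (by simpa using hr0.ne') 0]
      rw [PiLp.norm_single, Real.norm_of_nonneg hr0.le, PiLp.single_eq_same]
      field_simp
    rw [hflux, norm_mul, norm_pow, Complex.norm_real, Real.norm_of_nonneg hr0.le]
    gcongr
    simpa [pderiv3] using ContinuousLinearMap.le_of_opNorm_le _ hr (EuclideanSpace.single 0 1)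
  refine squeeze_zero_norm' hbound ?_
  have hsq : Continuous fun r : ℝ => B * r ^ 2 := by fun_prop
  simpa using (hsq.tendsto 0).mono_left nhdsWithin_le_nhds

namespace IsPotential

variable {M : Matrix (Fin 3) (Fin 3) ℝ} {f Ψ : E3 → ℂ}

theorem apply_eq_of_reflection (h : IsPotential M f Ψ) {x y : E3} (hxy : ‖x‖ = ‖y‖)
    (hM : ∀ n, quadSymbol M ((ℝ ∙ (x - y))ᗮ.reflection n) = quadSymbol M n)
    (hf : ∀ n, f ((ℝ ∙ (x - y))ᗮ.reflection n) = f n) : Ψ x = Ψ y := by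
  rw [← Submodule.reflection_sub hxy]
  exact (h.2.2.2 _ hM hf x).symm

theorem exists_hasRadialFlux (h : IsPotential (normSqM vecD1) (fun x => e ‖x‖ / ‖x‖) Ψ) :
    ∃ F : ℝ → ℂ, DifferentiableOn ℝ F (Set.Ioi 0) ∧ HasRadialFlux Ψ F := by
  set u : ℝ → ℂ := fun r => Ψ (EuclideanSpace.single 0 r)
  have hrad : Set.EqOn Ψ (fun x => u ‖x‖) {0}ᶜ := fun x _ =>
    h.apply_eq_of_reflection (by simp) (fun n => by simp [quadSymbol_normSqM_vecD1])
      fun n => by simp only [LinearIsometryEquiv.norm_map]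
  have hu : ContDiffOn ℝ ∞ u (Set.Ioi 0) :=
    h.1.comp (contDiff_euclideanSpace_single 0).contDiffOn fun r hr => by
      simpa using (ne_of_gt hr : r ≠ 0)
  obtain ⟨hdiff, hderiv⟩ := (contDiffOn_infty_iff_deriv_of_isOpen isOpen_Ioi).1 hu
  refine ⟨fun r => (r : ℂ) ^ 2 * deriv u r,
    .mul (by fun_prop) (hderiv.differentiableOn (by simp)),
    hasRadialFlux_of_eqOn_comp_norm hrad fun r hr => ?_⟩
  have hrc : (r : ℂ) ≠ 0 := Complex.ofReal_ne_zero.2 hr.ne'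
  rw [mul_div_cancel_left₀ _ (pow_ne_zero 2 hrc)]
  exact (hdiff.differentiableAt (Ioi_mem_nhds hr)).hasDerivAt

theorem hasRadialFlux (he : Continuous e)
    (h : IsPotential (normSqM vecD1) (fun x => e ‖x‖ / ‖x‖) Ψ) :
    HasRadialFlux Ψ (enclosedSource e) := by
  obtain ⟨F, hF, hflux⟩ := h.exists_hasRadialFlux
  obtain ⟨-, heq, ⟨B, hB⟩, -⟩ := h
  have hF' : ∀ r > 0, HasDerivAt F (r * e r) r := fun r hr => by
    have hderiv := (hF.differentiableAt (Ioi_mem_nhds hr)).hasDerivAt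
    have hnorm : ‖EuclideanSpace.single (0 : Fin 3) r‖ = r := by simp [abs_of_pos hr]
    have hne : EuclideanSpace.single (0 : Fin 3) r ≠ 0 := by simpa using hr.ne'
    have hrc : (r : ℂ) ≠ 0 := Complex.ofReal_ne_zero.2 hr.ne'
    have hlap := heq _ hne
    rw [toC_normSqM_vecD1, hflux.quadOp_one hne (by rwa [hnorm])] at hlap
    simp only [hnorm] at hlap
    rw [div_eq_div_iff (pow_ne_zero 2 hrc) hrc] at hlap
    exact hderiv.congr_deriv (mul_right_cancel₀ hrc (by linear_combination hlap))
  have hgauss : ∀ r > 0, enclosedSource e r = F r := fun r hr => by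
    have hFcont := (hF' r hr).continuousAt.tendsto.mono_left (nhdsWithin_le_nhds (s := Set.Iio r))
    rw [enclosedSource, intervalIntegral.integral_eq_sub_of_hasDerivAt_of_tendsto hr
      (fun s hs => hF' s hs.1) ((Complex.continuous_ofReal.mul he).intervalIntegrable _ _)
      (hflux.tendsto_zero hB) hFcont, sub_zero]
  intro x hx i
  rw [hflux x hx i, hgauss _ (norm_pos_iff.2 hx)]

end IsPotential

end RadialPotential

section HorizontalPotential

theorem apply_eq_apply_zero_of_harmonicOnNhd {F : Type*} [NormedAddCommGroup F] [NormedSpace ℝ F]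
    [CompleteSpace F] {g : ℂ → F} (hg : InnerProductSpace.HarmonicOnNhd g Set.univ)
    (hrot : ∀ w w', ‖w‖ = ‖w'‖ → g w = g w') (w : ℂ) : g w = g 0 := by
  rw [← (hg.mono (Set.subset_univ _)).circleAverage_eq (c := 0) (R := ‖w‖)]
  refine (Real.circleAverage_const_on_circle fun w' hw' => hrot w' w ?_).symm
  simpa using hw'

theorem quadSymbol_normSqM_vecD2 (n : E3) : quadSymbol (normSqM vecD2) n = ‖n‖ ^ 2 - n 2 ^ 2 := by
  have hquad : quadSymbol (normSqM vecD2) n = n 0 ^ 2 + n 1 ^ 2 := by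
    simp [quadSymbol, normSqM, tensorSq, vecD2, Fin.sum_univ_three, ← sq]
  rw [hquad, EuclideanSpace.real_norm_sq_eq, Fin.sum_univ_three, add_sub_cancel_right]

theorem quadOp_normSqM_vecD2 (f : E3 → ℂ) (x : E3) :
    quadOp (toC (normSqM vecD2)) f x = pderiv3 0 (pderiv3 0 f) x + pderiv3 1 (pderiv3 1 f) x := by
  simp [quadOp, toC, normSqM, tensorSq, vecD2, Fin.sum_univ_three]

theorem quadOp_tensorSq_vecD2_eq_zero {f : E3 → ℂ} {x : E3}
    (h : ∀ i, ∀ k ∈ ({0, 1} : Set (Fin 3)), pderiv3 i (pderiv3 k f) x = 0) (a b : Fin 3) :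
    quadOp (toC (tensorSq vecD2 a b)) f x = 0 := by
  refine Finset.sum_eq_zero fun j _ => Finset.sum_eq_zero fun k _ => ?_
  rcases eq_or_ne k 2 with rfl | hk
  · have hcol : vecD2 b 2 = 0 := by fin_cases b <;> rfl
    simp [toC, tensorSq, hcol]
  · rw [h j k (by fin_cases k <;> simp_all), mul_zero]

theorem pderiv3_zero (i : Fin 3) : pderiv3 i (fun _ => 0) = fun _ => 0 := by
  funext x
  simp [pderiv3]

theorem isPotential_zero (M : Matrix (Fin 3) (Fin 3) ℝ) : IsPotential M (fun _ => 0) fun _ => 0 :=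
  ⟨contDiffOn_const, fun x _ => by simp [quadOp, pderiv3_zero], ⟨0, by simp⟩, fun _ _ _ _ => rfl⟩

/-- The plane `{x | x 2 = z}`, parametrized by `ℂ`. -/
noncomputable def horizontalPlane (z : ℝ) (w : ℂ) : E3 := !₂[w.re, w.im, z]

theorem hasFDerivAt_horizontalPlane (z : ℝ) (w : ℂ) :
    HasFDerivAt (horizontalPlane z)
      (Complex.reCLM.smulRight (EuclideanSpace.single 0 1) +
        Complex.imCLM.smulRight (EuclideanSpace.single 1 1) : ℂ →L[ℝ] E3) w := by
  have h : horizontalPlane z = fun w => (Complex.reCLM.smulRight (EuclideanSpace.single 0 1) +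
      Complex.imCLM.smulRight (EuclideanSpace.single 1 1) : ℂ →L[ℝ] E3) w +
        EuclideanSpace.single 2 z := by
    funext w
    ext i
    fin_cases i <;> simp [horizontalPlane]
  rw [h]
  exact (ContinuousLinearMap.hasFDerivAt _).add_const _

theorem contDiff_horizontalPlane (z : ℝ) : ContDiff ℝ ∞ (horizontalPlane z) :=
  contDiff_euclidean.2 fun i => by
    fin_cases i
    exacts [Complex.reCLM.contDiff, Complex.imCLM.contDiff, contDiff_const]

theorem norm_horizontalPlane_sq (z : ℝ) (w : ℂ) : ‖horizontalPlane z w‖ ^ 2 = ‖w‖ ^ 2 + z ^ 2 := by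
  rw [EuclideanSpace.norm_sq_eq, Complex.sq_norm, Complex.normSq_apply, Fin.sum_univ_three]
  simp [horizontalPlane, sq]

theorem horizontalPlane_ne_zero {z : ℝ} (hz : z ≠ 0) (w : ℂ) : horizontalPlane z w ≠ 0 :=
  fun h => hz (by simpa [horizontalPlane] using congrArg (· 2) h)

theorem fderiv_comp_horizontalPlane {f : E3 → ℂ} {z : ℝ} {w : ℂ}
    (hf : DifferentiableAt ℝ f (horizontalPlane z w)) :
    fderiv ℝ (fun w => f (horizontalPlane z w)) w 1 = pderiv3 0 f (horizontalPlane z w) ∧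
      fderiv ℝ (fun w => f (horizontalPlane z w)) w Complex.I =
        pderiv3 1 f (horizontalPlane z w) := by
  have h := hf.hasFDerivAt.comp w (hasFDerivAt_horizontalPlane z w)
  simp only [Function.comp_def] at h
  simp [h.fderiv, pderiv3]

namespace IsPotential

variable {f Ψ : E3 → ℂ}

theorem harmonicOnNhd_comp_horizontalPlane (h : IsPotential (normSqM vecD2) (fun _ => 0) Ψ)
    {z : ℝ} (hz : z ≠ 0) :
    InnerProductSpace.HarmonicOnNhd (fun w => Ψ (horizontalPlane z w)) Set.univ := by
  have hne := horizontalPlane_ne_zero hz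
  have hsmooth : ContDiff ℝ ∞ fun w => Ψ (horizontalPlane z w) :=
    contDiffOn_univ.1 (h.1.comp (contDiff_horizontalPlane z).contDiffOn fun w _ => hne w)
  have hfirst := fun w => fderiv_comp_horizontalPlane
    (differentiableAt_of_contDiffOn_compl_zero h.1 (hne w))
  have hsecond := fun i w => fderiv_comp_horizontalPlane
    (differentiableAt_of_contDiffOn_compl_zero (contDiffOn_pderiv3 h.1 i) (hne w))
  have happly : ∀ w v, iteratedFDeriv ℝ 2 (fun w => Ψ (horizontalPlane z w)) w ![v, v] =
      fderiv ℝ (fun w => fderiv ℝ (fun w => Ψ (horizontalPlane z w)) w v) w v := fun w v => by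
    rw [iteratedFDeriv_two_apply, fderiv_clm_apply _ (differentiableAt_const v)]
    · simp
    · exact (hsmooth.fderiv_right (m := ∞) (by simp)).differentiable (by simp) w
  refine fun w _ => ⟨(contDiff_infty.1 hsmooth 2).contDiffAt, .of_forall fun w => ?_⟩
  rw [InnerProductSpace.laplacian_eq_iteratedFDeriv_complexPlane]
  simp only [happly]
  rw [funext fun w => (hfirst w).1, funext fun w => (hfirst w).2, (hsecond 0 w).1, (hsecond 1 w).2,
    ← quadOp_normSqM_vecD2, h.2.1 _ (hne w), Pi.zero_apply]

theorem comp_horizontalPlane_eq_of_norm_eq (h : IsPotential (normSqM vecD2) (fun _ => 0) Ψ)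
    (z : ℝ) {w w' : ℂ} (hw : ‖w‖ = ‖w'‖) :
    Ψ (horizontalPlane z w) = Ψ (horizontalPlane z w') := by
  refine h.apply_eq_of_reflection ?_ (fun n => ?_) fun _ => rfl
  · rw [← sq_eq_sq₀ (norm_nonneg _) (norm_nonneg _), norm_horizontalPlane_sq,
      norm_horizontalPlane_sq, hw]
  · set U := (ℝ ∙ (horizontalPlane z w - horizontalPlane z w'))ᗮ.reflection
    have hvertical : U (EuclideanSpace.single 2 1) = EuclideanSpace.single 2 1 :=
      Submodule.reflection_mem_subspace_eq_self <|
        Submodule.mem_orthogonal_singleton_iff_inner_right.2 <| by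
          simp [EuclideanSpace.inner_single_right, horizontalPlane]
    have hheight : U n 2 = n 2 := by
      have := U.inner_map_map n (EuclideanSpace.single 2 1)
      simpa [hvertical, EuclideanSpace.inner_single_right] using this
    rw [quadSymbol_normSqM_vecD2, quadSymbol_normSqM_vecD2, U.norm_map, hheight]

theorem pderiv3_eq_zero_of_apply_two_ne_zero (h : IsPotential (normSqM vecD2) (fun _ => 0) Ψ)
    {x : E3} (hx : x 2 ≠ 0) {k : Fin 3} (hk : k ∈ ({0, 1} : Set (Fin 3))) : pderiv3 k Ψ x = 0 := by
  set w : ℂ := ⟨x 0, x 1⟩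
  have hxw : x = horizontalPlane (x 2) w := by
    ext i
    fin_cases i <;> rfl
  have hconst : (fun w => Ψ (horizontalPlane (x 2) w)) = fun _ => Ψ (horizontalPlane (x 2) 0) :=
    funext <| apply_eq_apply_zero_of_harmonicOnNhd (h.harmonicOnNhd_comp_horizontalPlane hx)
      fun _ _ => h.comp_horizontalPlane_eq_of_norm_eq (x 2)
  obtain ⟨hre, him⟩ := fderiv_comp_horizontalPlane (differentiableAt_of_contDiffOn_compl_zero h.1
    (horizontalPlane_ne_zero hx w))
  simp only [hconst, fderiv_const_apply, zero_apply, ← hxw] at hre him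
  rcases hk with rfl | rfl
  exacts [hre.symm, him.symm]

theorem pderiv3_eq_zero (h : IsPotential (normSqM vecD2) (fun _ => 0) Ψ)
    {k : Fin 3} (hk : k ∈ ({0, 1} : Set (Fin 3))) : Set.EqOn (pderiv3 k Ψ) (fun _ => 0) {0}ᶜ := by
  have hdense : Dense {x : E3 | x 2 ≠ 0} := (dense_compl_singleton (0 : ℝ)).preimage
    (f := EuclideanSpace.proj (𝕜 := ℝ) 2) <|
      ContinuousLinearMap.isOpenMap _ fun z => ⟨EuclideanSpace.single 2 z, by simp⟩
  refine Set.EqOn.of_subset_closure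
    (fun x hx => h.pderiv3_eq_zero_of_apply_two_ne_zero hx hk)
    (contDiffOn_pderiv3 h.1 k).continuousOn continuousOn_const (fun x hx hx0 => hx ?_)
    (hdense.closure_eq ▸ Set.subset_univ _)
  rw [hx0]
  rfl

theorem quadOp_tensorSq_vecD2 (h : IsPotential (normSqM vecD2) (fun _ => 0) Ψ) {x : E3}
    (hx : x ≠ 0) (a b : Fin 3) : quadOp (toC (tensorSq vecD2 a b)) Ψ x = 0 :=
  quadOp_tensorSq_vecD2_eq_zero
    (fun i k hk => by rw [pderiv3_congr (h.pderiv3_eq_zero hk) hx i, pderiv3_zero]) a b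

end IsPotential

end HorizontalPotential

section SphericalWaves

/-- The amplitude `e^{ikr} / 4π` of the spherical wave with wavenumber `k`. -/
noncomputable def waveAmplitude (k : ℂ) (r : ℝ) : ℂ :=
  Complex.exp (Complex.I * k * r) / (4 * Real.pi)

/-- The outgoing spherical wave `e^{ikr} / 4πr`. -/
noncomputable def sphericalWave (k : ℂ) (x : E3) : ℂ := waveAmplitude k ‖x‖ / ‖x‖

/-- The radial flux `r² ∂ᵣ (e^{ikr} / 4πr)` of the spherical wave. -/
noncomputable def waveFlux (k : ℂ) (r : ℝ) : ℂ := (Complex.I * k * r - 1) * waveAmplitude k r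

theorem contDiff_waveAmplitude (k : ℂ) {n : WithTop ℕ∞} : ContDiff ℝ n (waveAmplitude k) :=
  ((contDiff_const.mul Complex.ofRealCLM.contDiff).cexp).div_const _

theorem hasDerivAt_waveAmplitude (k : ℂ) (r : ℝ) :
    HasDerivAt (waveAmplitude k) (Complex.I * k * waveAmplitude k r) r := by
  have hphase : HasDerivAt (fun r : ℝ => Complex.I * k * (r : ℂ)) (Complex.I * k * 1) r :=
    (Complex.ofRealCLM.hasDerivAt (x := r)).const_mul (Complex.I * k)
  refine (hphase.cexp.div_const _).congr_deriv ?_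
  rw [waveAmplitude]
  ring

theorem waveFlux_zero (k : ℂ) : waveFlux k 0 = -1 / (4 * Real.pi) := by
  simp [waveFlux, waveAmplitude, div_eq_mul_inv]

theorem hasDerivAt_waveFlux (k : ℂ) (r : ℝ) :
    HasDerivAt (waveFlux k) (-k ^ 2 * (r * waveAmplitude k r)) r := by
  have hphase : HasDerivAt (fun r : ℝ => Complex.I * k * (r : ℂ) - 1) (Complex.I * k * 1) r :=
    ((Complex.ofRealCLM.hasDerivAt (x := r)).const_mul (Complex.I * k)).sub_const 1
  refine (hphase.mul (hasDerivAt_waveAmplitude k r)).congr_deriv ?_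
  linear_combination k ^ 2 * r * waveAmplitude k r * Complex.I_sq

theorem hasRadialFlux_sphericalWave (k : ℂ) : HasRadialFlux (sphericalWave k) (waveFlux k) := by
  refine hasRadialFlux_of_eqOn_comp_norm (u := fun r => waveAmplitude k r / r) (fun _ _ => rfl)
    fun r hr => ?_
  have hrc : (r : ℂ) ≠ 0 := Complex.ofReal_ne_zero.2 hr.ne'
  refine ((hasDerivAt_waveAmplitude k r).fun_div Complex.ofRealCLM.hasDerivAt hrc).congr_deriv ?_
  rw [waveFlux, Complex.ofRealCLM_apply, Complex.ofRealCLM_apply, Complex.ofReal_one]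
  ring

theorem sq_mul_enclosedSource_waveAmplitude (k : ℂ) (r : ℝ) :
    k ^ 2 * enclosedSource (waveAmplitude k) r = waveFlux k 0 - waveFlux k r := by
  have hint : Continuous fun s : ℝ => -k ^ 2 * (s * waveAmplitude k s) :=
    continuous_const.mul
      (Complex.continuous_ofReal.mul (contDiff_waveAmplitude k (n := 0)).continuous)
  have hFTC := intervalIntegral.integral_eq_sub_of_hasDerivAt (a := 0) (b := r)
    (fun s _ => hasDerivAt_waveFlux k s) (hint.intervalIntegrable _ _)
  rw [intervalIntegral.integral_const_mul] at hFTC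
  rw [enclosedSource]
  linear_combination -hFTC

theorem differentiableAt_sphericalWave (k : ℂ) {x : E3} (hx : x ≠ 0) :
    DifferentiableAt ℝ (sphericalWave k) x :=
  (hasFDerivAt_comp_norm hx ((hasDerivAt_waveAmplitude k ‖x‖).fun_div
    Complex.ofRealCLM.hasDerivAt (ofReal_norm_ne_zero hx))).differentiableAt

theorem locallyIntegrable_sphericalWave (k : ℂ) : LocallyIntegrable (sphericalWave k) := by
  have hw : Continuous fun r : ℝ => r * waveAmplitude k r :=
    Complex.continuous_ofReal.mul (contDiff_waveAmplitude k (n := 0)).continuous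
  refine (locallyIntegrable_comp_norm_div_norm_sq hw).congr ?_
  filter_upwards [Measure.ae_ne volume 0] with x hx
  have hr := ofReal_norm_ne_zero hx
  rw [sphericalWave]
  field_simp

theorem integral_sphericalWave_mul_quadOp_one (k : ℂ) {φ : E3 → ℂ} (hφ : IsTestFunction φ) :
    ∫ x, sphericalWave k x * quadOp 1 φ x = -k ^ 2 * (∫ x, sphericalWave k x * φ x) - φ 0 := by
  have hsource : Continuous fun r : ℝ => -k ^ 2 * (r * waveAmplitude k r) :=
    continuous_const.mul
      (Complex.continuous_ofReal.mul (contDiff_waveAmplitude k (n := 0)).continuous)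
  have hpi : (Real.pi : ℂ) ≠ 0 := Complex.ofReal_ne_zero.2 Real.pi_ne_zero
  rw [(hasRadialFlux_sphericalWave k).integral_mul_quadOp_one
    (fun x hx => differentiableAt_sphericalWave k hx) (locallyIntegrable_sphericalWave k)
    (hasDerivAt_waveFlux k) hsource hφ, waveFlux_zero, ← integral_const_mul, sub_eq_add_neg]
  congr 1
  · refine integral_congr_ae ?_
    filter_upwards [Measure.ae_ne volume 0] with x hx
    have hr := ofReal_norm_ne_zero hx
    rw [sphericalWave]
    field_simp
  · field_simp

theorem isScalarFundamental_const_mul_sphericalWave (m k α : ℂ) :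
    IsScalarFundamental (m • 1) (m * k ^ 2) (-(m * α)) fun x => α * sphericalWave k x := by
  have hw := locallyIntegrable_sphericalWave k
  refine ⟨hw.smul α, fun φ hφ hc => ?_⟩
  have htest : IsTestFunction φ := ⟨hφ, hc⟩
  have hlap := (htest.quadOp 1).integrable_mul hw
  have hmul := htest.integrable_mul hw
  calc ∫ x, α * sphericalWave k x * (quadOp (m • 1) φ x + m * k ^ 2 * φ x)
      = ∫ x, α * m * (sphericalWave k x * quadOp 1 φ x) +
          α * m * k ^ 2 * (sphericalWave k x * φ x) := by
        simp only [quadOp_smul]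
        congr with x
        ring
    _ = α * m * (∫ x, sphericalWave k x * quadOp 1 φ x) +
          α * m * k ^ 2 * ∫ x, sphericalWave k x * φ x := by
        rw [integral_add (hlap.const_mul _) (hmul.const_mul _), integral_const_mul,
          integral_const_mul]
    _ = -(m * α) * φ 0 := by
        rw [integral_sphericalWave_mul_quadOp_one k htest]
        ring

end SphericalWaves

section IsotropicTensors

theorem mediumIIITensor_eq {R : Type} [CommRing R] {μ : Moduli R} (h : μ.m66 = μ.m44)
    (i j k l : Fin 3) :
    mediumIIITensor μ i j k l =
      (μ.m11 - 2 * μ.m44) * ((1 : Matrix (Fin 3) (Fin 3) R) i j *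
        (1 : Matrix (Fin 3) (Fin 3) R) k l) +
      μ.m44 * ((1 : Matrix (Fin 3) (Fin 3) R) i k * (1 : Matrix (Fin 3) (Fin 3) R) j l +
        (1 : Matrix (Fin 3) (Fin 3) R) i l * (1 : Matrix (Fin 3) (Fin 3) R) j k) := by
  fin_cases i <;> fin_cases j <;> fin_cases k <;> fin_cases l <;>
    simp [mediumIIITensor, mediumIIIVoigt, voigtIndex, h] <;> ring

theorem isIsotropicTensor_mediumIIITensor {μ : Moduli ℝ} (h : μ.m66 = μ.m44) :
    IsIsotropicTensor (mediumIIITensor μ) := by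
  intro Q hQ i j k l
  have hrows : ∀ i j : Fin 3, ∑ a, Q i a * Q j a = (1 : Matrix (Fin 3) (Fin 3) ℝ) i j :=
    fun i j => by
      simpa only [Matrix.mul_apply, Matrix.transpose_apply] using
        congr_fun₂ ((Matrix.mem_orthogonalGroup_iff (Fin 3) ℝ).1 hQ) i j
  rw [mediumIIITensor_eq h i j k l, ← hrows i j, ← hrows k l, ← hrows i k, ← hrows j l,
    ← hrows i l, ← hrows j k]
  simp only [mediumIIITensor_eq h, mul_add, Finset.sum_add_distrib, Matrix.one_apply, mul_ite,
    mul_one, mul_zero, Finset.sum_ite_irrel, Finset.sum_const_zero, Finset.sum_ite_eq,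
    Finset.mem_univ, if_true]
  simp only [Fin.sum_univ_three]
  ring

theorem quadOp_christoffel {μ : Moduli ℂ} (h : μ.m66 = μ.m44) {φ : E3 → ℂ} {x : E3}
    (hφ : ContDiffAt ℝ 2 φ x) (i j : Fin 3) :
    quadOp (christoffel μ i j) φ x = (μ.m11 - μ.m44) * pderiv3 i (pderiv3 j φ) x +
      (1 : Matrix (Fin 3) (Fin 3) ℂ) i j * (μ.m44 * quadOp 1 φ x) := by
  simp only [quadOp, christoffel, Matrix.of_apply, mediumIIITensor_eq h]
  calc _ = (μ.m11 - 2 * μ.m44) * pderiv3 i (pderiv3 j φ) x + μ.m44 *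
        ((1 : Matrix (Fin 3) (Fin 3) ℂ) i j * quadOp 1 φ x + pderiv3 j (pderiv3 i φ) x) := by
        simp [Matrix.one_apply, mul_add, add_mul, Finset.sum_add_distrib, quadOp, Finset.mul_sum]
    _ = _ := by
        rw [pderiv3_comm hφ j i, quadOp]
        ring

end IsotropicTensors

section ElasticFundamental

/-- The entry `(i, k)` of `(Γ(∇) + κ I) φ`, which pairs with `G` in `IsElasticFundamental`. -/
noncomputable def christoffelWaveOp (μ : Moduli ℂ) (κ : ℂ) (φ : E3 → ℂ) (i k : Fin 3) (x : E3) :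
    ℂ :=
  quadOp (christoffel μ i k) φ x + κ * (1 : Matrix (Fin 3) (Fin 3) ℂ) i k * φ x

variable {μ : Moduli ℂ} {κ : ℂ} {S Ψ φ χ : E3 → ℂ}

theorem IsTestFunction.christoffelWaveOp (hφ : IsTestFunction φ) (μ : Moduli ℂ) (κ : ℂ)
    (i k : Fin 3) : IsTestFunction (christoffelWaveOp μ κ φ i k) :=
  (hφ.quadOp _).add (hφ.const_mul _)

theorem christoffelWaveOp_eq (hμ : μ.m66 = μ.m44) (hφ : ContDiff ℝ ∞ φ) (i k : Fin 3) :
    christoffelWaveOp μ κ φ i k = fun x => (μ.m11 - μ.m44) * pderiv3 i (pderiv3 k φ) x +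
      (1 : Matrix (Fin 3) (Fin 3) ℂ) i k * (quadOp (μ.m44 • 1) φ x + κ * φ x) := by
  funext x
  rw [christoffelWaveOp, quadOp_christoffel hμ (contDiff_infty.1 hφ 2).contDiffAt, quadOp_smul]
  ring

theorem pderiv3_quadOp_one (hφ : ContDiff ℝ ∞ φ) (i : Fin 3) (x : E3) :
    pderiv3 i (quadOp 1 φ) x = quadOp 1 (pderiv3 i φ) x := by
  have hcomm : ∀ {ψ : E3 → ℂ}, ContDiff ℝ ∞ ψ → ∀ k,
      pderiv3 i (pderiv3 k ψ) = pderiv3 k (pderiv3 i ψ) := fun hψ k =>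
    funext fun x => pderiv3_comm (contDiff_infty.1 hψ 2).contDiffAt i k
  have hlap : quadOp 1 φ = fun x => ∑ k, pderiv3 k (pderiv3 k φ) x := funext (quadOp_one φ)
  rw [hlap, quadOp_one, pderiv3_sum fun k _ =>
    (contDiff_pderiv3 (contDiff_pderiv3 hφ k) k).differentiable (by simp) x]
  exact Finset.sum_congr rfl fun k _ => by
    rw [hcomm (contDiff_pderiv3 hφ k), hcomm hφ]

theorem sum_pderiv3_christoffelWaveOp (hμ : μ.m66 = μ.m44) (hφ : IsTestFunction φ) (i : Fin 3)
    (x : E3) :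
    ∑ k, pderiv3 k (christoffelWaveOp μ κ φ i k) x =
      quadOp (μ.m11 • 1) (pderiv3 i φ) x + κ * pderiv3 i φ x := by
  have hdiff : ∀ {ψ : E3 → ℂ}, IsTestFunction ψ → DifferentiableAt ℝ ψ x := fun hψ =>
    hψ.contDiff.differentiable (by simp) x
  have hterm : ∀ k, pderiv3 k (christoffelWaveOp μ κ φ i k) x =
      (μ.m11 - μ.m44) * pderiv3 k (pderiv3 k (pderiv3 i φ)) x +
        (1 : Matrix (Fin 3) (Fin 3) ℂ) i k *
          (μ.m44 * quadOp 1 (pderiv3 k φ) x + κ * pderiv3 k φ x) := fun k => by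
    have hcomm : pderiv3 i (pderiv3 k φ) = pderiv3 k (pderiv3 i φ) :=
      funext fun x => pderiv3_comm (contDiff_infty.1 hφ.contDiff 2).contDiffAt i k
    have hshear := (hφ.quadOp 1).const_mul μ.m44
    have hmass := hφ.const_mul κ
    simp only [christoffelWaveOp_eq hμ hφ.contDiff, quadOp_smul, hcomm]
    rw [pderiv3_add (hdiff (((hφ.pderiv3 i).pderiv3 k).const_mul _))
        (hdiff ((hshear.add hmass).const_mul _)),
      pderiv3_const_mul (hdiff ((hφ.pderiv3 i).pderiv3 k)),
      pderiv3_const_mul (hdiff (hshear.add hmass)), pderiv3_add (hdiff hshear) (hdiff hmass),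
      pderiv3_const_mul (hdiff (hφ.quadOp 1)), pderiv3_const_mul (hdiff hφ),
      pderiv3_quadOp_one hφ.contDiff]
  simp only [hterm, Finset.sum_add_distrib, ← Finset.mul_sum, ← quadOp_one, quadOp_smul,
    Matrix.one_apply, ite_mul, one_mul, zero_mul, Finset.sum_ite_eq, Finset.mem_univ, if_true]
  ring

theorem IsScalarFundamental.integral_mul_christoffelWaveOp {s : ℂ} (hμ : μ.m66 = μ.m44)
    (hS : IsScalarFundamental (μ.m44 • 1) κ s S) (hφ : IsTestFunction φ) (i j : Fin 3) :
    ∫ x, S x * christoffelWaveOp μ κ φ i j x =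
      (μ.m11 - μ.m44) * (∫ x, S x * pderiv3 j (pderiv3 i φ) x) +
        s * (1 : Matrix (Fin 3) (Fin 3) ℂ) i j * φ 0 := by
  have hhess := ((hφ.pderiv3 i).pderiv3 j).integrable_mul hS.1
  have hscalar := ((hφ.quadOp (μ.m44 • 1)).add (hφ.const_mul κ)).integrable_mul hS.1
  rw [mul_right_comm, ← hS.2 φ hφ.contDiff hφ.hasCompactSupport,
    mul_comm _ ((1 : Matrix (Fin 3) (Fin 3) ℂ) i j), ← integral_const_mul, ← integral_const_mul,
    ← integral_add (hhess.const_mul _) (hscalar.const_mul _)]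
  refine integral_congr_ae (.of_forall fun x => ?_)
  simp only [christoffelWaveOp_eq hμ hφ.contDiff,
    pderiv3_comm (contDiff_infty.1 hφ.contDiff 2).contDiffAt i j]
  ring

theorem sum_integral_pderiv3_pderiv3_mul_christoffelWaveOp (hμ : μ.m66 = μ.m44)
    (hΨ : ContDiffOn ℝ ∞ Ψ {0}ᶜ) {j : Fin 3} (hgrad : LocallyIntegrable (pderiv3 j Ψ))
    (hhess : ∀ k, LocallyIntegrable (pderiv3 k (pderiv3 j Ψ))) (hφ : IsTestFunction φ)
    (i : Fin 3) :
    ∑ k, ∫ x, pderiv3 k (pderiv3 j Ψ) x * christoffelWaveOp μ κ φ i k x =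
      -∫ x, pderiv3 j Ψ x * (quadOp (μ.m11 • 1) (pderiv3 i φ) x + κ * pderiv3 i φ x) := by
  have htest := hφ.christoffelWaveOp μ κ i
  simp only [← sum_pderiv3_christoffelWaveOp hμ hφ, Finset.mul_sum]
  rw [integral_finsetSum _ fun k _ => ((htest k).pderiv3 k).integrable_mul hgrad,
    ← Finset.sum_neg_distrib]
  refine Finset.sum_congr rfl fun k _ => ?_
  rw [integral_mul_pderiv3_eq_neg (fun x hx => differentiableAt_of_contDiffOn_compl_zero
    (contDiffOn_pderiv3 hΨ j) hx) hgrad (hhess k) (htest k), neg_neg]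

theorem isElasticFundamental_add_hessian {s : ℂ} {G : E3 → Matrix (Fin 3) (Fin 3) ℂ}
    (hμ : μ.m66 = μ.m44) (hS : IsScalarFundamental (μ.m44 • 1) κ s S)
    (hΨ : ContDiffOn ℝ ∞ Ψ {0}ᶜ) (hgrad : ∀ i, LocallyIntegrable (pderiv3 i Ψ))
    (hhess : ∀ i j, LocallyIntegrable (pderiv3 i (pderiv3 j Ψ)))
    (hlong : ∀ j χ, IsTestFunction χ →
      ∫ x, pderiv3 j Ψ x * (quadOp (μ.m11 • 1) χ x + κ * χ x) =
        (μ.m11 - μ.m44) * ∫ x, S x * pderiv3 j χ x)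
    (hG : ∀ x ≠ 0, ∀ i j, G x i j =
      S x * (1 : Matrix (Fin 3) (Fin 3) ℂ) i j + pderiv3 i (pderiv3 j Ψ) x) :
    IsElasticFundamental μ κ s G := by
  refine ⟨fun i j => ?_, fun φ hφ hc i j => ?_⟩
  · refine ((hS.1.smul ((1 : Matrix (Fin 3) (Fin 3) ℂ) i j)).add (hhess i j)).congr ?_
    filter_upwards [Measure.ae_ne volume 0] with x hx
    simp [hG x hx, mul_comm]
  have htest : IsTestFunction φ := ⟨hφ, hc⟩
  have hT := htest.christoffelWaveOp μ κ i
  have hhessT := fun k => (hT k).integrable_mul (hhess k j)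
  calc ∫ x, ∑ k, G x k j * christoffelWaveOp μ κ φ i k x
      = ∫ x, (S x * christoffelWaveOp μ κ φ i j x +
          ∑ k, pderiv3 k (pderiv3 j Ψ) x * christoffelWaveOp μ κ φ i k x) := by
        refine integral_congr_ae ?_
        filter_upwards [Measure.ae_ne volume 0] with x hx
        simp [hG x hx, add_mul, Finset.sum_add_distrib, Matrix.one_apply]
    _ = (∫ x, S x * christoffelWaveOp μ κ φ i j x) +
          ∑ k, ∫ x, pderiv3 k (pderiv3 j Ψ) x * christoffelWaveOp μ κ φ i k x := by
        rw [integral_add ((hT j).integrable_mul hS.1)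
          (integrable_finsetSum _ fun k _ => hhessT k), integral_finsetSum _ fun k _ => hhessT k]
    _ = s * (1 : Matrix (Fin 3) (Fin 3) ℂ) i j * φ 0 := by
        rw [hS.integral_mul_christoffelWaveOp hμ htest,
          sum_integral_pderiv3_pderiv3_mul_christoffelWaveOp hμ hΨ (hgrad j)
            (fun k => hhess k j) htest, hlong j _ (htest.pderiv3 i)]
        ring

theorem integral_pderiv3_mul_quadOp_one (hΨ : ContDiffOn ℝ ∞ Ψ {0}ᶜ)
    (hgrad : ∀ i, LocallyIntegrable (pderiv3 i Ψ))
    (hhess : ∀ i j, LocallyIntegrable (pderiv3 i (pderiv3 j Ψ))) (hχ : IsTestFunction χ)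
    (j : Fin 3) :
    ∫ x, pderiv3 j Ψ x * quadOp 1 χ x = -∫ x, quadOp 1 Ψ x * pderiv3 j χ x := by
  have hparts : ∀ {ψ : E3 → ℂ}, IsTestFunction ψ → ∀ i k,
      ∫ x, pderiv3 i Ψ x * pderiv3 k ψ x = -∫ x, pderiv3 k (pderiv3 i Ψ) x * ψ x :=
    fun hψ i k => integral_mul_pderiv3_eq_neg (fun x hx =>
      differentiableAt_of_contDiffOn_compl_zero (contDiffOn_pderiv3 hΨ i) hx) (hgrad i)
      (hhess k i) hψ
  simp only [quadOp_one, Finset.mul_sum, Finset.sum_mul]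
  rw [integral_finsetSum _ fun k _ => ((hχ.pderiv3 k).pderiv3 k).integrable_mul (hgrad j),
    integral_finsetSum _ fun k _ => (hχ.pderiv3 j).integrable_mul (hhess k k),
    ← Finset.sum_neg_distrib]
  refine Finset.sum_congr rfl fun k _ => ?_
  calc ∫ x, pderiv3 j Ψ x * pderiv3 k (pderiv3 k χ) x
      = -∫ x, pderiv3 j (pderiv3 k Ψ) x * pderiv3 k χ x := by
        rw [hparts (hχ.pderiv3 k)]
        refine congrArg Neg.neg (integral_congr_ae ?_)
        filter_upwards [Measure.ae_ne volume 0] with x hx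
        rw [pderiv3_comm (contDiffOn_infty.1 hΨ 2 |>.contDiffAt
          (isOpen_compl_singleton.mem_nhds hx))]
    _ = ∫ x, pderiv3 k Ψ x * pderiv3 k (pderiv3 j χ) x := by
        rw [← hparts (hχ.pderiv3 k)]
        congr with x
        rw [pderiv3_comm (contDiff_infty.1 hχ.contDiff 2).contDiffAt]
    _ = -∫ x, pderiv3 k (pderiv3 k Ψ) x * pderiv3 j χ x := hparts (hχ.pderiv3 j) k k

end ElasticFundamental

section WavePotential

variable {α₀ α₁ k₀ k₁ κ : ℂ} {Ψ χ : E3 → ℂ} {x : E3}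

/-- The difference `α₀ e^{ik₀r} / 4π - α₁ e^{ik₁r} / 4π` of two wave amplitudes. -/
noncomputable def waveAmplitudeDiff (α₀ α₁ k₀ k₁ : ℂ) (r : ℝ) : ℂ :=
  α₀ * waveAmplitude k₀ r - α₁ * waveAmplitude k₁ r

/-- The difference `α₀ e^{ik₀r} / 4πr - α₁ e^{ik₁r} / 4πr` of two spherical waves, the source of
the potential of an isotropic Green function. -/
noncomputable def sphericalWaveDiff (α₀ α₁ k₀ k₁ : ℂ) (x : E3) : ℂ :=
  α₀ * sphericalWave k₀ x - α₁ * sphericalWave k₁ x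

theorem sphericalWaveDiff_eq (α₀ α₁ k₀ k₁ : ℂ) :
    sphericalWaveDiff α₀ α₁ k₀ k₁ = fun x => waveAmplitudeDiff α₀ α₁ k₀ k₁ ‖x‖ / ‖x‖ := by
  funext x
  simp only [sphericalWaveDiff, sphericalWave, waveAmplitudeDiff]
  ring

theorem contDiff_waveAmplitudeDiff (α₀ α₁ k₀ k₁ : ℂ) {n : WithTop ℕ∞} :
    ContDiff ℝ n (waveAmplitudeDiff α₀ α₁ k₀ k₁) :=
  (contDiff_const.mul (contDiff_waveAmplitude k₀)).sub
    (contDiff_const.mul (contDiff_waveAmplitude k₁))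

theorem enclosedSource_waveAmplitudeDiff (α₀ α₁ k₀ k₁ : ℂ) (r : ℝ) :
    enclosedSource (waveAmplitudeDiff α₀ α₁ k₀ k₁) r =
      α₀ * enclosedSource (waveAmplitude k₀) r - α₁ * enclosedSource (waveAmplitude k₁) r :=
  enclosedSource_const_mul_sub_const_mul (contDiff_waveAmplitude k₀ (n := 0)).continuous
    (contDiff_waveAmplitude k₁ (n := 0)).continuous α₀ α₁ r

theorem exists_isPotential_sphericalWaveDiff (α₀ α₁ k₀ k₁ : ℂ) :
    ∃ Ψ, IsPotential (normSqM vecD1) (sphericalWaveDiff α₀ α₁ k₀ k₁) Ψ := by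
  rw [sphericalWaveDiff_eq]
  exact ⟨_, isPotential_integral_enclosedSource (contDiff_waveAmplitudeDiff _ _ _ _)⟩

namespace IsPotential

theorem hasRadialFlux_sphericalWaveDiff
    (h : IsPotential (normSqM vecD1) (sphericalWaveDiff α₀ α₁ k₀ k₁) Ψ) :
    HasRadialFlux Ψ (enclosedSource (waveAmplitudeDiff α₀ α₁ k₀ k₁)) := by
  rw [sphericalWaveDiff_eq] at h
  exact h.hasRadialFlux (contDiff_waveAmplitudeDiff α₀ α₁ k₀ k₁ (n := 0)).continuous

theorem mul_pderiv3_eq_sub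
    (h : IsPotential (normSqM vecD1) (sphericalWaveDiff α₀ α₁ k₀ k₁) Ψ)
    (h₀ : κ * α₀ = k₀ ^ 2) (h₁ : κ * α₁ = k₁ ^ 2) (hx : x ≠ 0) (i : Fin 3) :
    κ * pderiv3 i Ψ x = pderiv3 i (sphericalWave k₁) x - pderiv3 i (sphericalWave k₀) x := by
  have hflux : κ * enclosedSource (waveAmplitudeDiff α₀ α₁ k₀ k₁) ‖x‖ =
      waveFlux k₁ ‖x‖ - waveFlux k₀ ‖x‖ := by
    rw [enclosedSource_waveAmplitudeDiff, mul_sub, ← mul_assoc, ← mul_assoc, h₀, h₁,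
      sq_mul_enclosedSource_waveAmplitude, sq_mul_enclosedSource_waveAmplitude, waveFlux_zero,
      waveFlux_zero]
    ring
  rw [h.hasRadialFlux_sphericalWaveDiff x hx, hasRadialFlux_sphericalWave k₀ x hx,
    hasRadialFlux_sphericalWave k₁ x hx, ← mul_assoc, mul_div_assoc', hflux]
  ring

theorem locallyIntegrable_pderiv3
    (h : IsPotential (normSqM vecD1) (sphericalWaveDiff α₀ α₁ k₀ k₁) Ψ) (i : Fin 3) :
    LocallyIntegrable (pderiv3 i Ψ) :=
  h.hasRadialFlux_sphericalWaveDiff.locallyIntegrable_pderiv3 (contDiff_enclosedSource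
    (contDiff_waveAmplitudeDiff α₀ α₁ k₀ k₁)).continuous i

theorem locallyIntegrable_pderiv3_pderiv3
    (h : IsPotential (normSqM vecD1) (sphericalWaveDiff α₀ α₁ k₀ k₁) Ψ) (i j : Fin 3) :
    LocallyIntegrable (pderiv3 i (pderiv3 j Ψ)) :=
  have he := (contDiff_waveAmplitudeDiff α₀ α₁ k₀ k₁ (n := 0)).continuous
  h.hasRadialFlux_sphericalWaveDiff.locallyIntegrable_pderiv3_pderiv3
    (hasDerivAt_enclosedSource he) (Complex.continuous_ofReal.mul he) enclosedSource_zero i j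

theorem integral_pderiv3_mul_quadOp_one
    (h : IsPotential (normSqM vecD1) (sphericalWaveDiff α₀ α₁ k₀ k₁) Ψ) (hχ : IsTestFunction χ)
    (j : Fin 3) :
    ∫ x, pderiv3 j Ψ x * quadOp 1 χ x =
      α₁ * (∫ x, sphericalWave k₁ x * pderiv3 j χ x) -
        α₀ * ∫ x, sphericalWave k₀ x * pderiv3 j χ x := by
  have hw := fun k => (hχ.pderiv3 j).integrable_mul (locallyIntegrable_sphericalWave k)
  rw [_root_.integral_pderiv3_mul_quadOp_one h.1 h.locallyIntegrable_pderiv3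
      h.locallyIntegrable_pderiv3_pderiv3 hχ,
    ← integral_neg, ← integral_const_mul, ← integral_const_mul,
    ← integral_sub ((hw k₁).const_mul _) ((hw k₀).const_mul _)]
  refine integral_congr_ae ?_
  filter_upwards [Measure.ae_ne volume 0] with x hx
  rw [← toC_normSqM_vecD1, h.2.1 x hx, sphericalWaveDiff]
  ring

theorem mul_integral_pderiv3_mul
    (h : IsPotential (normSqM vecD1) (sphericalWaveDiff α₀ α₁ k₀ k₁) Ψ)
    (h₀ : κ * α₀ = k₀ ^ 2) (h₁ : κ * α₁ = k₁ ^ 2) (hχ : IsTestFunction χ) (j : Fin 3) :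
    κ * ∫ x, pderiv3 j Ψ x * χ x =
      (∫ x, sphericalWave k₀ x * pderiv3 j χ x) - ∫ x, sphericalWave k₁ x * pderiv3 j χ x := by
  have hgrad := fun k => (hasRadialFlux_sphericalWave k).locallyIntegrable_pderiv3
    (continuous_iff_continuousAt.2 fun r => (hasDerivAt_waveFlux k r).continuousAt) j
  have hparts := fun k => integral_mul_pderiv3_eq_neg
    (fun x hx => differentiableAt_sphericalWave k hx) (locallyIntegrable_sphericalWave k)
    (hgrad k) hχ
  rw [hparts, hparts, neg_sub_neg, ← integral_const_mul,
    ← integral_sub (hχ.integrable_mul (hgrad k₁)) (hχ.integrable_mul (hgrad k₀))]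
  refine integral_congr_ae ?_
  filter_upwards [Measure.ae_ne volume 0] with x hx
  rw [← mul_assoc, h.mul_pderiv3_eq_sub h₀ h₁ hx, sub_mul]

theorem integral_pderiv3_mul_quadOp_add
    (h : IsPotential (normSqM vecD1) (sphericalWaveDiff α₀ α₁ k₀ k₁) Ψ) {m : ℂ}
    (h₀ : κ * α₀ = k₀ ^ 2) (h₁ : κ * α₁ = k₁ ^ 2) (hm : m * α₀ = 1) (hχ : IsTestFunction χ)
    (j : Fin 3) :
    ∫ x, pderiv3 j Ψ x * (quadOp (m • 1) χ x + κ * χ x) =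
      (m * α₁ - 1) * ∫ x, sphericalWave k₁ x * pderiv3 j χ x := by
  have hgrad := h.locallyIntegrable_pderiv3 j
  calc ∫ x, pderiv3 j Ψ x * (quadOp (m • 1) χ x + κ * χ x)
      = ∫ x, (m * (pderiv3 j Ψ x * quadOp 1 χ x) + κ * (pderiv3 j Ψ x * χ x)) := by
        congr with x
        rw [quadOp_smul]
        ring
    _ = m * (∫ x, pderiv3 j Ψ x * quadOp 1 χ x) + κ * ∫ x, pderiv3 j Ψ x * χ x := by
        rw [integral_add (((hχ.quadOp 1).integrable_mul hgrad).const_mul _)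
          ((hχ.integrable_mul hgrad).const_mul _), integral_const_mul, integral_const_mul]
    _ = (m * α₁ - 1) * ∫ x, sphericalWave k₁ x * pderiv3 j χ x := by
        rw [h.integral_pderiv3_mul_quadOp_one hχ, h.mul_integral_pderiv3_mul h₀ h₁ hχ]
        linear_combination -(∫ x, sphericalWave k₀ x * pderiv3 j χ x) * hm

theorem isElasticFundamental {μ : Moduli ℂ} {G : E3 → Matrix (Fin 3) (Fin 3) ℂ}
    (h : IsPotential (normSqM vecD1) (sphericalWaveDiff α₀ α₁ k₀ k₁) Ψ)
    (hμ : μ.m66 = μ.m44) (h₀ : κ * α₀ = k₀ ^ 2) (h₁ : κ * α₁ = k₁ ^ 2) (h11 : μ.m11 * α₀ = 1)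
    (h44 : μ.m44 * α₁ = 1)
    (hG : ∀ x ≠ 0, ∀ i j, G x i j =
      α₁ * sphericalWave k₁ x * (1 : Matrix (Fin 3) (Fin 3) ℂ) i j + pderiv3 i (pderiv3 j Ψ) x) :
    IsElasticFundamental μ κ (-1) G := by
  have hS : IsScalarFundamental (μ.m44 • 1) κ (-1) fun x => α₁ * sphericalWave k₁ x := by
    have hκ : κ = μ.m44 * k₁ ^ 2 := by linear_combination μ.m44 * h₁ - κ * h44
    rw [hκ, ← h44]
    exact isScalarFundamental_const_mul_sphericalWave _ _ _
  refine isElasticFundamental_add_hessian hμ hS h.1 h.locallyIntegrable_pderiv3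
    h.locallyIntegrable_pderiv3_pderiv3 (fun j χ hχ => ?_) hG
  rw [h.integral_pderiv3_mul_quadOp_add h₀ h₁ h11 hχ]
  simp only [mul_assoc, integral_const_mul]
  linear_combination (∫ x, sphericalWave k₁ x * pderiv3 j χ x) * h44

end IsPotential

end WavePotential

section IsotropicMedium

theorem quadSymbol_single (M : Matrix (Fin 3) (Fin 3) ℝ) (j : Fin 3) :
    quadSymbol M (EuclideanSpace.single j 1) = M j j := by
  simp [quadSymbol]

theorem m66_eq_m44_of_quadSymbol_eigL {v c : Moduli ℝ} {β : ℝ}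
    (h : ∀ n, quadSymbol (eigL v 1) n = β * quadSymbol (eigL c 1) n) (hc : c.m66 = c.m44) :
    v.m66 = v.m44 := by
  have h66 : v.m66 = β * c.m66 := by simpa [quadSymbol_single, eigL] using h (.single 0 1)
  have h44 : v.m44 = β * c.m44 := by simpa [quadSymbol_single, eigL] using h (.single 2 1)
  rw [h66, h44, hc]

theorem shear_ratio_eq_of_quadSymbol_eigL {v c : Moduli ℝ} {β₁ β₂ : ℝ}
    (h₁ : ∀ n, quadSymbol (eigL v 1) n = β₁ * quadSymbol (eigL c 1) n)
    (h₂ : ∀ n, quadSymbol (eigL v 2) n = β₂ * quadSymbol (eigL c 2) n) (hc : c.m44 ≠ 0) :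
    β₁ = β₂ := by
  have hβ₁ : v.m44 = β₁ * c.m44 := by simpa [quadSymbol_single, eigL] using h₁ (.single 2 1)
  have hβ₂ : v.m44 = β₂ * c.m44 := by simpa [quadSymbol_single, eigL] using h₂ (.single 2 1)
  exact mul_right_cancel₀ hc (hβ₁.symm.trans hβ₂)

namespace WaveData

variable {P : WaveData}

/-- The elastic modulus that governs mode `i` of the medium when `c₆₆ = c₄₄`. -/
def modulus (P : WaveData) : Fin 3 → ℝ := ![P.c.m11, P.c.m44, P.c.m44]

/-- The speed of mode `i` when `c₆₆ = c₄₄`: `c₁` for the longitudinal mode and `c₄` for the two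
shear modes. -/
noncomputable def speed (P : WaveData) (i : Fin 3) : ℝ := √(P.modulus i / P.ρ)

/-- The wavenumber `Kᵢ / cᵢ` of mode `i`. -/
noncomputable def wavenumber (P : WaveData) (i : Fin 3) : ℂ := P.K i / P.speed i

/-- The amplitude `(1 - βᵢ Â) / ρcᵢ²` of `Φᵢ` relative to the spherical wave. -/
noncomputable def amplitude (P : WaveData) (i : Fin 3) : ℂ := P.loss i / P.modulus i

theorem modulus_pos (h11 : 0 < P.c.m11) (h44 : 0 < P.c.m44) (i : Fin 3) : 0 < P.modulus i := by
  fin_cases i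
  exacts [h11, h44, h44]

theorem speed_pos (hρ : 0 < P.ρ) {i : Fin 3} (hm : 0 < P.modulus i) : 0 < P.speed i :=
  Real.sqrt_pos.2 (div_pos hm hρ)

theorem speed_sq_mul (hρ : 0 < P.ρ) {i : Fin 3} (hm : 0 < P.modulus i) :
    (P.speed i : ℂ) ^ 2 * P.ρ = P.modulus i := by
  rw [speed, ← Complex.ofReal_pow, Real.sq_sqrt (div_pos hm hρ).le, ← Complex.ofReal_mul,
    div_mul_cancel₀ _ hρ.ne']

theorem b_eq_speed (hiso : P.c.m66 = P.c.m44) (i j : Fin 3) : P.b i j = P.speed i := by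
  fin_cases i <;> fin_cases j <;> simp [b, speed, modulus, c1, c4, c6, hiso]

theorem toC_eigL_eq_modulus_smul_one (hiso : P.c.m66 = P.c.m44) (i : Fin 3) :
    toC (eigL P.c i) = (P.modulus i : ℂ) • 1 := by
  fin_cases i <;> ext j k <;> fin_cases j <;> fin_cases k <;> simp [toC, eigL, modulus, hiso]

theorem τ_eq_norm_div_speed (hiso : P.c.m66 = P.c.m44) (i : Fin 3) (x : E3) :
    P.τ i x = ‖x‖ / P.speed i := by
  have hsum : ∑ j, x j ^ 2 / P.b i j ^ 2 = (‖x‖ / P.speed i) ^ 2 := by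
    rw [div_pow, EuclideanSpace.real_norm_sq_eq, Finset.sum_div]
    simp only [b_eq_speed hiso]
  have hs : 0 ≤ P.speed i := Real.sqrt_nonneg _
  rw [τ, hsum, Real.sqrt_sq (div_nonneg (norm_nonneg x) hs)]

theorem Φ_one_eq_Φ_two (hβ : P.β 1 = P.β 2) (hiso : P.c.m66 = P.c.m44) : P.Φ 1 = P.Φ 2 := by
  have hspeed : P.speed 1 = P.speed 2 := rfl
  funext x
  simp only [Φ, τ_eq_norm_div_speed hiso, profile, K, loss, b_eq_speed hiso, hspeed, hβ]

theorem profile_div_speed (hρ : 0 < P.ρ) (hiso : P.c.m66 = P.c.m44) {i : Fin 3}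
    (hm : 0 < P.modulus i) (r : ℝ) :
    P.profile i (r / P.speed i) = P.amplitude i * (waveAmplitude (P.wavenumber i) r / r) := by
  have hs : (P.speed i : ℂ) ≠ 0 := Complex.ofReal_ne_zero.2 (speed_pos hρ hm).ne'
  have hphase : Complex.I * P.K i * (r / P.speed i : ℝ) =
      Complex.I * P.wavenumber i * r := by
    rw [wavenumber]
    push_cast
    ring
  rw [profile, hphase, amplitude, ← speed_sq_mul hρ hm, waveAmplitude]
  simp only [b_eq_speed hiso, Finset.prod_const, Finset.card_univ, Fintype.card_fin]
  push_cast
  field_simp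

theorem Φ_eq_amplitude_mul_sphericalWave (hρ : 0 < P.ρ) (hiso : P.c.m66 = P.c.m44) {i : Fin 3}
    (hm : 0 < P.modulus i) :
    P.Φ i = fun x => P.amplitude i * sphericalWave (P.wavenumber i) x := by
  funext x
  rw [Φ, τ_eq_norm_div_speed hiso, profile_div_speed hρ hiso hm, sphericalWave]

theorem mul_amplitude_eq_wavenumber_sq (hsq : ∀ z : ℂ, P.sq z ^ 2 = z) (hρ : 0 < P.ρ)
    {i : Fin 3} (hm : 0 < P.modulus i) :
    P.ρ * (P.freq : ℂ) ^ 2 * P.amplitude i = P.wavenumber i ^ 2 := by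
  have hs : (P.speed i : ℂ) ≠ 0 := Complex.ofReal_ne_zero.2 (speed_pos hρ hm).ne'
  have hρc : (P.ρ : ℂ) ≠ 0 := Complex.ofReal_ne_zero.2 hρ.ne'
  rw [wavenumber, div_pow, K, hsq, amplitude, ← speed_sq_mul hρ hm]
  field_simp

theorem isScalarFundamental_Φ (hsq : ∀ z : ℂ, P.sq z ^ 2 = z) (hρ : 0 < P.ρ)
    (hiso : P.c.m66 = P.c.m44) {i : Fin 3} (hm : 0 < P.modulus i) :
    IsScalarFundamental (toC (eigL P.c i)) (P.ρ * (P.freq : ℂ) ^ 2 * P.loss i) (-P.loss i)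
      (P.Φ i) := by
  have hmc : (P.modulus i : ℂ) ≠ 0 := Complex.ofReal_ne_zero.2 hm.ne'
  have hloss : P.loss i = P.modulus i * P.amplitude i := (mul_div_cancel₀ _ hmc).symm
  rw [toC_eigL_eq_modulus_smul_one hiso, Φ_eq_amplitude_mul_sphericalWave hρ hiso hm, hloss,
    mul_left_comm, mul_amplitude_eq_wavenumber_sq hsq hρ hm]
  exact isScalarFundamental_const_mul_sphericalWave _ _ _

theorem Φ_zero_sub_Φ_one (hρ : 0 < P.ρ) (hiso : P.c.m66 = P.c.m44) (hm : ∀ i, 0 < P.modulus i) :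
    (fun x => P.Φ 0 x - P.Φ 1 x) =
      sphericalWaveDiff (P.amplitude 0) (P.amplitude 1) (P.wavenumber 0) (P.wavenumber 1) := by
  rw [Φ_eq_amplitude_mul_sphericalWave hρ hiso (hm 0),
    Φ_eq_amplitude_mul_sphericalWave hρ hiso (hm 1)]
  rfl

theorem speed_cube_mul_integral_profile (hρ : 0 < P.ρ) (hiso : P.c.m66 = P.c.m44) {i : Fin 3}
    (hm : 0 < P.modulus i) (r : ℝ) :
    (P.speed i : ℂ) ^ 3 * ∫ h in (0 : ℝ)..(r / P.speed i), (h : ℂ) ^ 2 * P.profile i h =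
      P.amplitude i * enclosedSource (waveAmplitude (P.wavenumber i)) r := by
  have hs := (speed_pos hρ hm).ne'
  have hscale : (P.speed i : ℂ) * ∫ h in (0 : ℝ)..(r / P.speed i), (h : ℂ) ^ 2 * P.profile i h =
      ∫ t in (0 : ℝ)..r, ((t / P.speed i : ℝ) : ℂ) ^ 2 * P.profile i (t / P.speed i) := by
    simpa only [zero_div, Complex.real_smul] using (intervalIntegral.integral_comp_div
      (a := 0) (b := r) (fun h : ℝ => (h : ℂ) ^ 2 * P.profile i h) hs).symm
  rw [pow_succ, mul_assoc, hscale, enclosedSource, ← intervalIntegral.integral_const_mul,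
    ← intervalIntegral.integral_const_mul]
  refine intervalIntegral.integral_congr fun t _ => ?_
  have hsc : (P.speed i : ℂ) ≠ 0 := Complex.ofReal_ne_zero.2 hs
  simp only [profile_div_speed hρ hiso hm, Complex.ofReal_div]
  rcases eq_or_ne (t : ℂ) 0 with ht | ht
  · simp only [ht, zero_div, zero_mul, mul_zero, ne_eq, OfNat.ofNat_ne_zero, not_false_eq_true,
      zero_pow]
  · field_simp

theorem isotropicGreen_eq (hρ : 0 < P.ρ) (hiso : P.c.m66 = P.c.m44)
    (hm : ∀ i, 0 < P.modulus i) {Ψ : E3 → ℂ}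
    (hΨ : IsPotential (normSqM vecD1) (fun x => P.Φ 0 x - P.Φ 1 x) Ψ) {x : E3} (hx : x ≠ 0) :
    P.isotropicGreen x = P.Φ 1 x • (1 : Matrix (Fin 3) (Fin 3) ℂ) +
      Matrix.of fun a b => quadOp (toC (tensorSq vecD1 a b)) Ψ x := by
  have hr := ofReal_norm_ne_zero hx
  have hdiff := congr_fun (Φ_zero_sub_Φ_one hρ hiso hm) x
  rw [sphericalWaveDiff_eq] at hdiff
  have hgauss : ((P.c1 : ℂ) ^ 3 * ∫ h in (0 : ℝ)..(‖x‖ / P.c1), (h : ℂ) ^ 2 * P.profile 0 h) -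
      ((P.c4 : ℂ) ^ 3 * ∫ h in (0 : ℝ)..(‖x‖ / P.c4), (h : ℂ) ^ 2 * P.profile 1 h) =
      enclosedSource (waveAmplitudeDiff (P.amplitude 0) (P.amplitude 1) (P.wavenumber 0)
        (P.wavenumber 1)) ‖x‖ := by
    rw [enclosedSource_waveAmplitudeDiff, ← speed_cube_mul_integral_profile hρ hiso (hm 0),
      ← speed_cube_mul_integral_profile hρ hiso (hm 1)]
    rfl
  rw [Φ_zero_sub_Φ_one hρ hiso hm] at hΨ
  ext i j
  rw [isotropicGreen]
  simp only [hgauss, Matrix.add_apply, Matrix.smul_apply, Matrix.sub_apply, Matrix.of_apply,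
    smul_eq_mul, quadOp_tensorSq_vecD1]
  rw [hΨ.hasRadialFlux_sphericalWaveDiff.pderiv3_pderiv3 hx
    (hasDerivAt_enclosedSource (contDiff_waveAmplitudeDiff _ _ _ _ (n := 0)).continuous _)]
  have hradial : (‖x‖ : ℂ) * waveAmplitudeDiff (P.amplitude 0) (P.amplitude 1) (P.wavenumber 0)
      (P.wavenumber 1) ‖x‖ / ‖x‖ ^ 2 = P.Φ 0 x - P.Φ 1 x := by
    rw [hdiff]
    field_simp
  push_cast
  rw [hradial]
  ring

theorem exists_isPotential_Φ_zero_sub_Φ_one (hρ : 0 < P.ρ) (hiso : P.c.m66 = P.c.m44)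
    (hm : ∀ i, 0 < P.modulus i) :
    ∃ Ψ, IsPotential (normSqM vecD1) (fun x => P.Φ 0 x - P.Φ 1 x) Ψ := by
  rw [Φ_zero_sub_Φ_one hρ hiso hm]
  exact exists_isPotential_sphericalWaveDiff _ _ _ _

theorem isMediumIIIGreen_iff (hΦ : P.Φ 1 = P.Φ 2) {G : E3 → Matrix (Fin 3) (Fin 3) ℂ} :
    P.IsMediumIIIGreen G ↔
      ∃ Ψ, IsPotential (normSqM vecD1) (fun x => P.Φ 0 x - P.Φ 1 x) Ψ ∧
        ∀ x, x ≠ 0 → G x = P.Φ 1 x • (1 : Matrix (Fin 3) (Fin 3) ℂ) +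
          Matrix.of fun a b => quadOp (toC (tensorSq vecD1 a b)) Ψ x := by
  have hshear : ∀ {Ψ}, IsPotential (normSqM vecD2) (fun _ => 0) Ψ → ∀ x, x ≠ 0 →
      (Matrix.of fun a b => quadOp (toC (tensorSq vecD2 a b)) Ψ x) = 0 := fun hΨ x hx => by
    ext a b
    exact hΨ.quadOp_tensorSq_vecD2 hx a b
  simp only [IsMediumIIIGreen, ← hΦ, sub_self]
  constructor
  · rintro ⟨Ψ, Ψ₂, hΨ, hΨ₂, hG⟩
    exact ⟨Ψ, hΨ, fun x hx => by rw [hG x hx, hshear hΨ₂ x hx, add_zero]⟩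
  · rintro ⟨Ψ, hΨ, hG⟩
    have hzero := isPotential_zero (normSqM vecD2)
    exact ⟨Ψ, fun _ => 0, hΨ, hzero, fun x hx => by rw [hG x hx, hshear hzero x hx, add_zero]⟩

theorem isElasticFundamental_isotropicGreen (hsq : ∀ z : ℂ, P.sq z ^ 2 = z) (hρ : 0 < P.ρ)
    (hiso : P.c.m66 = P.c.m44) (hm : ∀ i, 0 < P.modulus i) (hβ : P.β 1 = P.β 2)
    (hloss : ∀ i, P.loss i ≠ 0) :
    IsElasticFundamental P.viscoModuli (P.ρ * (P.freq : ℂ) ^ 2) (-1) P.isotropicGreen := by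
  have hmc : ∀ i, (P.modulus i : ℂ) ≠ 0 := fun i => Complex.ofReal_ne_zero.2 (hm i).ne'
  have hmul : ∀ i, P.modulus i / P.loss i * P.amplitude i = 1 := fun i => by
    rw [amplitude, div_mul_div_cancel₀ (hloss i), div_self (hmc i)]
  have hshear : P.loss 1 = P.loss 2 := by rw [loss, loss, hβ]
  obtain ⟨Ψ, hΨ⟩ := exists_isPotential_Φ_zero_sub_Φ_one hρ hiso hm
  have hdiff := Φ_zero_sub_Φ_one hρ hiso hm ▸ hΨ
  refine hdiff.isElasticFundamental (by simp only [viscoModuli, hiso, hshear])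
    (mul_amplitude_eq_wavenumber_sq hsq hρ (hm 0)) (mul_amplitude_eq_wavenumber_sq hsq hρ (hm 1))
    (hmul 0) (by rw [viscoModuli, ← hshear]; exact hmul 1) fun x hx i j => ?_
  rw [isotropicGreen_eq hρ hiso hm hΨ hx, Φ_eq_amplitude_mul_sphericalWave hρ hiso (hm 1)]
  simp only [Matrix.add_apply, Matrix.smul_apply, Matrix.of_apply, quadOp_tensorSq_vecD1,
    smul_eq_mul]

end WaveData

end IsotropicMedium

theorem mainTheorem4 (P : WaveData) (v : Moduli ℝ)
    (hρ : 0 < P.ρ) (hc11 : 0 < P.c.m11) (hc44 : 0 < P.c.m44)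
    (hsq : ∀ z : ℂ, P.sq z ^ 2 = z)
    (hβ : ∀ i n, quadSymbol (eigL v i) n = P.β i * quadSymbol (eigL P.c i) n)
    (hiso : P.c.m66 = P.c.m44) :
    -- the medium is isotropic
    (IsIsotropicTensor (mediumIIITensor P.c) ∧ IsIsotropicTensor (mediumIIITensor v)) ∧
    -- the two shear modes coincide
    (P.β 1 = P.β 2 ∧
      (∀ x, P.τ 0 x = ‖x‖ / P.c1 ∧ P.τ 1 x = ‖x‖ / P.c4 ∧ P.τ 2 x = ‖x‖ / P.c4) ∧
      P.Φ 1 = P.Φ 2) ∧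
    -- the scalar functions solve the Helmholtz equations of the three modes
    (∀ i, IsScalarFundamental (toC (eigL P.c i)) (P.ρ * (P.freq : ℂ) ^ 2 * P.loss i)
      (-P.loss i) (P.Φ i)) ∧
    -- the Green function of Medium III exists and is given by the closed form
    P.IsMediumIIIGreen P.isotropicGreen ∧
    (∀ G, P.IsMediumIIIGreen G → ∀ x, x ≠ 0 → G x = P.isotropicGreen x) ∧
    -- the closed form is `Φ₂ I + D₁⊗D₁ M₁⁻¹ (Φ₁ - Φ₂)`
    (∀ Ψ, IsPotential (normSqM vecD1) (fun x => P.Φ 0 x - P.Φ 1 x) Ψ → ∀ x, x ≠ 0 →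
      P.isotropicGreen x = P.Φ 1 x • (1 : Matrix (Fin 3) (Fin 3) ℂ) +
        Matrix.of fun a b => quadOp (toC (tensorSq vecD1 a b)) Ψ x) ∧
    -- it is a Green function of the viscoelastic wave operator in the frequency domain
    ((∀ i, P.loss i ≠ 0) →
      IsElasticFundamental P.viscoModuli (P.ρ * (P.freq : ℂ) ^ 2) (-1) P.isotropicGreen) := by
  have hm := WaveData.modulus_pos hc11 hc44
  have hv : v.m66 = v.m44 := m66_eq_m44_of_quadSymbol_eigL (hβ 1) hiso
  have hβ12 : P.β 1 = P.β 2 := shear_ratio_eq_of_quadSymbol_eigL (hβ 1) (hβ 2) hc44.ne'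
  have hΦ : P.Φ 1 = P.Φ 2 := WaveData.Φ_one_eq_Φ_two hβ12 hiso
  have hτ := WaveData.τ_eq_norm_div_speed hiso
  have hclosed := fun Ψ hΨ x hx => WaveData.isotropicGreen_eq hρ hiso hm (Ψ := Ψ) hΨ (x := x) hx
  obtain ⟨Ψ, hΨ⟩ := WaveData.exists_isPotential_Φ_zero_sub_Φ_one hρ hiso hm
  refine ⟨⟨isIsotropicTensor_mediumIIITensor hiso, isIsotropicTensor_mediumIIITensor hv⟩,
    ⟨hβ12, fun x => ⟨hτ 0 x, hτ 1 x, hτ 2 x⟩, hΦ⟩,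
    fun i => WaveData.isScalarFundamental_Φ hsq hρ hiso (hm i),
    (WaveData.isMediumIIIGreen_iff hΦ).2 ⟨Ψ, hΨ, hclosed Ψ hΨ⟩, fun G hG x hx => ?_, hclosed,
    WaveData.isElasticFundamental_isotropicGreen hsq hρ hiso hm hβ12⟩
  obtain ⟨Ψ', hΨ', hG'⟩ := (WaveData.isMediumIIIGreen_iff hΦ).1 hG
  rw [hG' x hx, hclosed Ψ' hΨ' x hx]
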